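/- Let $X$ be a compact smooth $n$-dimensional manifold without boundary. An Einstein flow on $X$ over an interval $I\subset\mathbb R$ is a smooth family $(L(t),h(t),K(t))_{t\in I}$ of nonnegative functions $L$, Riemannian metrics $h$ and symmetric covariant $2$-tensor fields $K$ on $X$ such that, with $H=h^{ij}K_{ij}$, $K^0=K-\frac Hn h$ and with $R_{ij}$, $R$ the Ricci and scalar curvature of $h$, $$R-|K^0|^2+\Bigl(1-\frac1n\Bigr)H^2=0,\qquad \nabla_iK^i{}_j-\nabla_jH=0,$$ $$\frac{\partial h_{ij}}{\partial t}=-2LK_{ij},\qquad \frac{\partial K_{ij}}{\partial t}=LHK_{ij}-2Lh^{kl}K_{ik}K_{lj}-L_{;ij}+LR_{ij}.$$ It is an expanding CMC Einstein flow if $I=[t_0,\infty)$ or $I=(t_0,\infty)$ and $H$ is a negative, monotonically increasing function of $t$ alone that takes all values in $[H_0,0)$ for some $H_0<0$. Let $(L,h,K)$ be an expanding CMC Einstein flow on $X$ whose time parameter is the Hubble time $t=-n/H$. Then: (a) The measures $t^{-n}\,\mathrm{dvol}(X,h(t))$ are nonincreasing in $t\in I$, and there is a finite measure $\mathrm{dvol}_\infty$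 on $X$, absolutely continuous with respect to $\mathrm{dvol}(X,h(t))$ for each $t\in I$, such that $t^{-n}\,\mathrm{vol}(A,h(t))\to\mathrm{dvol}_\infty(A)$ as $t\to\infty$ for every Borel set $A\subset X$. (b) As $t\to\infty$, the density $\dfrac{t^{-n}\,\mathrm{dvol}(X,h(t))}{\mathrm{dvol}_\infty}$ (the Radon–Nikodym derivative of the $\mathrm{dvol}_\infty$-absolutely continuous part) tends to $1$ in $L^1(X,\mathrm{dvol}_\infty)$. (c) For $s>0$ put $L_s(u)=L(su)$, $h_s(u)=s^{-2}h(su)$, $K_s(u)=s^{-1}K(su)$, and let $|K^0|^2_s$ and $R_s$ be the squared norm of the trace-free part of $K_s$ with respect to $h_s$ and the scalar curvature of $h_s$. Then for every $\Lambda>1$, as $s\to\infty$, $$L_s-1\to0,\qquad |K^0|_s^2\,L_s\to0,\qquad \Bigl|R_s+\frac{n(n-1)}{u^2}\Bigr|L_s\to0$$ in $L^1\bigl([\Lambda^{-1},\Lambda]\times X,\ du\,\mathrm{dvol}_\infty\bigr)$. -/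

import Mathlib

open MeasureTheory Filter Topology Set
open scoped Manifold ContDiff ENNReal

noncomputable section

/-- The model space of `n`-dimensional manifolds. -/
abbrev Coord (n : ℕ) : Type := EuclideanSpace ℝ (Fin n)

/-- The components of a covariant 2-tensor field in a coordinate domain. -/
abbrev CoordTensor (n : ℕ) : Type := Coord n → Matrix (Fin n) (Fin n) ℝ

/-! ### Tensor calculus in local coordinates

`G` is the matrix `(h_ij)` of a Riemannian metric in a chart, so `(G y)⁻¹` is `(h^ij)`. -/

namespace CoordTensor

variable {n : ℕ}

/-- The coordinate partial derivative `∂_k f`. -/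
def pderiv (k : Fin n) (f : Coord n → ℝ) (y : Coord n) : ℝ :=
  fderiv ℝ f y (EuclideanSpace.single k 1)

/-- The trace `h^ij K_ij`. -/
def trace (G K : CoordTensor n) (y : Coord n) : ℝ :=
  ∑ i, ∑ j, (G y)⁻¹ i j * K y i j

/-- The trace-free part `K_ij - (h^kl K_kl / n) h_ij`. -/
def traceFree (G K : CoordTensor n) : CoordTensor n :=
  fun y => K y - (trace G K y / n) • G y

/-- The squared norm `h^ik h^jl T_ij T_kl`. -/
def normSq (G T : CoordTensor n) (y : Coord n) : ℝ :=
  ∑ i, ∑ j, ∑ k, ∑ l, (G y)⁻¹ i k * (G y)⁻¹ j l * T y i j * T y k l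

/-- The Christoffel symbol `Γ^k_ij = (1/2) h^kl (∂_i h_jl + ∂_j h_il - ∂_l h_ij)`. -/
def christoffel (G : CoordTensor n) (k i j : Fin n) (y : Coord n) : ℝ :=
  (1 / 2) * ∑ l, (G y)⁻¹ k l *
    (pderiv i (fun z => G z j l) y + pderiv j (fun z => G z i l) y
      - pderiv l (fun z => G z i j) y)

/-- The Ricci curvature
`R_ij = ∂_k Γ^k_ij - ∂_j Γ^k_ik + Γ^k_kl Γ^l_ij - Γ^k_jl Γ^l_ik`. -/
def ricci (G : CoordTensor n) (i j : Fin n) (y : Coord n) : ℝ :=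
  ∑ k, (pderiv k (christoffel G k i j) y - pderiv j (christoffel G k i k) y
    + ∑ l, (christoffel G k k l y * christoffel G l i j y
      - christoffel G k j l y * christoffel G l i k y))

/-- The scalar curvature `h^ij R_ij`. -/
def scalar (G : CoordTensor n) (y : Coord n) : ℝ :=
  ∑ i, ∑ j, (G y)⁻¹ i j * ricci G i j y

/-- The Hessian `f_{;ij} = ∂_i ∂_j f - Γ^k_ij ∂_k f`. -/
def hessian (G : CoordTensor n) (f : Coord n → ℝ) (i j : Fin n) (y : Coord n) : ℝ :=
  pderiv i (pderiv j f) y - ∑ k, christoffel G k i j y * pderiv k f y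

/-- The covariant derivative `∇_k T_ij = ∂_k T_ij - Γ^l_ki T_lj - Γ^l_kj T_il`. -/
def covDeriv (G T : CoordTensor n) (k i j : Fin n) (y : Coord n) : ℝ :=
  pderiv k (fun z => T z i j) y
    - ∑ l, (christoffel G l k i y * T y l j + christoffel G l k j y * T y i l)

/-- The divergence `∇_i T^i_j = h^ik ∇_k T_ij`. -/
def divergence (G T : CoordTensor n) (j : Fin n) (y : Coord n) : ℝ :=
  ∑ i, ∑ k, (G y)⁻¹ i k * covDeriv G T k i j y

end CoordTensor

/-! ### Tensor fields on a manifold -/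

section Manifold

variable (n : ℕ) (X : Type*) [TopologicalSpace X] [ChartedSpace (Coord n) X]

/-- A (not necessarily smooth) covariant 2-tensor field on `X`. -/
abbrev TwoTensor : Type _ :=
  (x : X) → TangentSpace (𝓡 n) x →L[ℝ] TangentSpace (𝓡 n) x →L[ℝ] ℝ

variable {n X}

/-- The `i`-th coordinate vector field of the chart `c`, at the point with coordinates `y`. -/
def coordVector (c : OpenPartialHomeomorph X (Coord n)) (y : Coord n) (i : Fin n) :
    TangentSpace (𝓡 n) (c.symm y) :=
  mfderiv (𝓡 n) (𝓡 n) c.symm y (EuclideanSpace.single i 1 : Coord n)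

namespace TwoTensor

/-- The components of a 2-tensor field in the chart `c`; meaningful on `c.target`. -/
def comp (T : TwoTensor n X) (c : OpenPartialHomeomorph X (Coord n)) : CoordTensor n :=
  fun y => Matrix.of fun i j => T (c.symm y) (coordVector c y i) (coordVector c y j)

/-- The trace `h^ij K_ij` as a function on `X`, computed in a chart around the point. -/
def trace (h K : TwoTensor n X) (x : X) : ℝ :=
  CoordTensor.trace (h.comp (chartAt (Coord n) x)) (K.comp (chartAt (Coord n) x))
    (chartAt (Coord n) x x)

/-- `|K^0|^2` as a function on `X`, where `K^0` is the trace-free part of `K` and the norm and the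
trace are those of the metric `h`. -/
def traceFreeNormSq (h K : TwoTensor n X) (x : X) : ℝ :=
  CoordTensor.normSq (h.comp (chartAt (Coord n) x))
    (CoordTensor.traceFree (h.comp (chartAt (Coord n) x)) (K.comp (chartAt (Coord n) x)))
    (chartAt (Coord n) x x)

/-- The scalar curvature of the metric `h` as a function on `X`. -/
def scalarCurvature (h : TwoTensor n X) (x : X) : ℝ :=
  CoordTensor.scalar (h.comp (chartAt (Coord n) x)) (chartAt (Coord n) x x)

variable [MeasurableSpace X]

/-- The Riemannian measure of `h` on the domain of the chart `c`, as a measure on `X` that vanishes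
outside that domain: the image of `√(det h_ij) dy` under the inverse of the chart. -/
def chartVolume (h : TwoTensor n X) (c : OpenPartialHomeomorph X (Coord n)) : Measure X :=
  Measure.map c.symm ((volume.restrict c.target).withDensity
    fun y => ENNReal.ofReal (Real.sqrt (h.comp c y).det))

/-- The Riemannian measure `dvol(X, h)`: the least measure on `X` that dominates
`√(det h_ij) dy` on the domain of every chart. By the change of variables formula the measures of
two charts agree on the intersection of their domains, so this is the measure that is given by
`√(det h_ij) dy` on the domain of each chart. -/
def volumeMeasure (h : TwoTensor n X) : Measure X :=
  ⨆ c ∈ atlas (Coord n) X, h.chartVolume c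

end TwoTensor

/-! ### Einstein flows -/

variable (n X)

/-- The data of a flow: the lapse functions `L(t)`, metrics `h(t)` and 2-tensor fields `K(t)`.
Only the values at times in the time interval under consideration matter. -/
structure FlowData where
  L : ℝ → X → ℝ
  h : ℝ → TwoTensor n X
  K : ℝ → TwoTensor n X

variable {n X}

namespace FlowData

/-- The mean curvature `H = h^ij K_ij`. -/
def H (F : FlowData n X) (t : ℝ) (x : X) : ℝ := (F.h t).trace (F.K t) x

/-- `|K^0|^2`, where `K^0 = K - (H/n) h`. -/
def K0sq (F : FlowData n X) (t : ℝ) (x : X) : ℝ := (F.h t).traceFreeNormSq (F.K t) x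

/-- The scalar curvature of `h(t)`. -/
def R (F : FlowData n X) (t : ℝ) (x : X) : ℝ := (F.h t).scalarCurvature x

/-- The rescaled flow `L_s(u) = L(su)`, `h_s(u) = s⁻² h(su)`, `K_s(u) = s⁻¹ K(su)`. -/
def rescale (F : FlowData n X) (s : ℝ) : FlowData n X where
  L u := F.L (s * u)
  h u := fun x => (s ^ 2)⁻¹ • F.h (s * u) x
  K u := fun x => s⁻¹ • F.K (s * u) x

/-- The normalized volume measure `t⁻ⁿ dvol(X, h(t))`. -/
def normalizedVolume [MeasurableSpace X] (F : FlowData n X) (t : ℝ) : Measure X :=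
  ENNReal.ofReal (t ^ n)⁻¹ • (F.h t).volumeMeasure

/-- A smooth Einstein flow with time interval `I`. Smoothness is joint smoothness in time and
space of the components in local coordinates, and the tensor equations are required in every chart
of the atlas. At an endpoint of `I` time derivatives are one-sided. -/
structure IsEinsteinFlow (I : Set ℝ) (F : FlowData n X) : Prop where
  interval : I.OrdConnected
  lapse_nonneg : ∀ t ∈ I, ∀ x, 0 ≤ F.L t x
  metric_symm : ∀ t ∈ I, ∀ x v w, F.h t x v w = F.h t x w v
  metric_pos : ∀ t ∈ I, ∀ x v, v ≠ 0 → 0 < F.h t x v v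
  K_symm : ∀ t ∈ I, ∀ x v w, F.K t x v w = F.K t x w v
  smooth_L : ∀ c ∈ atlas (Coord n) X,
    ContDiffOn ℝ ∞ (fun p : ℝ × Coord n => F.L p.1 (c.symm p.2)) (I ×ˢ c.target)
  smooth_h : ∀ c ∈ atlas (Coord n) X, ∀ i j,
    ContDiffOn ℝ ∞ (fun p : ℝ × Coord n => (F.h p.1).comp c p.2 i j) (I ×ˢ c.target)
  smooth_K : ∀ c ∈ atlas (Coord n) X, ∀ i j,
    ContDiffOn ℝ ∞ (fun p : ℝ × Coord n => (F.K p.1).comp c p.2 i j) (I ×ˢ c.target)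
  /-- `R - |K^0|^2 + (1 - 1/n) H^2 = 0` -/
  hamiltonian : ∀ t ∈ I, ∀ c ∈ atlas (Coord n) X, ∀ y ∈ c.target,
    CoordTensor.scalar ((F.h t).comp c) y
      - CoordTensor.normSq ((F.h t).comp c)
          (CoordTensor.traceFree ((F.h t).comp c) ((F.K t).comp c)) y
      + (1 - 1 / (n : ℝ)) * CoordTensor.trace ((F.h t).comp c) ((F.K t).comp c) y ^ 2 = 0
  /-- `∇_i K^i_j - ∇_j H = 0` -/
  momentum : ∀ t ∈ I, ∀ c ∈ atlas (Coord n) X, ∀ y ∈ c.target, ∀ j,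
    CoordTensor.divergence ((F.h t).comp c) ((F.K t).comp c) j y
      - CoordTensor.pderiv j
          (CoordTensor.trace ((F.h t).comp c) ((F.K t).comp c)) y = 0
  /-- `∂h_ij/∂t = -2 L K_ij` -/
  evolution_h : ∀ t ∈ I, ∀ c ∈ atlas (Coord n) X, ∀ y ∈ c.target, ∀ i j,
    HasDerivWithinAt (fun τ => (F.h τ).comp c y i j)
      (-2 * F.L t (c.symm y) * (F.K t).comp c y i j) I t
  /-- `∂K_ij/∂t = L H K_ij - 2 L h^kl K_ik K_lj - L_{;ij} + L R_ij` -/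
  evolution_K : ∀ t ∈ I, ∀ c ∈ atlas (Coord n) X, ∀ y ∈ c.target, ∀ i j,
    HasDerivWithinAt (fun τ => (F.K τ).comp c y i j)
      (F.L t (c.symm y) * CoordTensor.trace ((F.h t).comp c) ((F.K t).comp c) y
            * (F.K t).comp c y i j
        - 2 * F.L t (c.symm y) * ∑ k, ∑ l, ((F.h t).comp c y)⁻¹ k l
            * (F.K t).comp c y i k * (F.K t).comp c y l j
        - CoordTensor.hessian ((F.h t).comp c) (fun z => F.L t (c.symm z)) i j y
        + F.L t (c.symm y) * CoordTensor.ricci ((F.h t).comp c) i j y) I t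

/-- An expanding CMC Einstein flow: the time interval is `[t₀, ∞)` or `(t₀, ∞)`, and `H` is a
negative nondecreasing function of `t` alone that takes all values in `[H₀, 0)` for some
`H₀ < 0`. -/
structure IsExpandingCMC (I : Set ℝ) (F : FlowData n X) : Prop extends
    IsEinsteinFlow I F where
  future : ∃ t₀ : ℝ, I = Ici t₀ ∨ I = Ioi t₀
  cmc : ∃ η : ℝ → ℝ, (∀ t ∈ I, ∀ x, F.H t x = η t) ∧ MonotoneOn η I ∧ (∀ t ∈ I, η t < 0) ∧
    ∃ H₀ < 0, Ico H₀ 0 ⊆ η '' I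

/-- The time parameter of the flow is the Hubble time `t = -n/H`. -/
def IsHubbleTime (I : Set ℝ) (F : FlowData n X) : Prop :=
  ∀ t ∈ I, ∀ x, t = -(n : ℝ) / F.H t x

end FlowData

end Manifold

/-- `F s → 0` in `L¹(μ)` as `s → ∞`. -/
def TendstoZeroL1 {α : Type*} [MeasurableSpace α] (μ : Measure α) (F : ℝ → α → ℝ) : Prop :=
  (∀ᶠ s in atTop, MemLp (F s) 1 μ) ∧ Tendsto (fun s => eLpNorm (F s) 1 μ) atTop (𝓝 0)

end

/-! In the Hubble time, the trace of the evolution equation for `K` and the Hamiltonian constraint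
combine to the elliptic equation `Δ L = |K⁰|² L - (n / t²) (1 - L)` for the lapse. At a maximum of
`L` it gives `L ≤ 1`, and its integral over `X` gives `∫ |K⁰|² L = (n / t²) ∫ (1 - L)`. The density
of `t⁻ⁿ dvol(X, h(t))` has logarithmic derivative `-(n / t) (1 - L) ≤ 0`, so these measures decrease
to a limit. The mass they lose between the times `s / Λ` and `s Λ` is the integral of
`(n / u) (1 - L_s)`, and it tends to zero as `s → ∞`; this controls `1 - L_s`, then `|K⁰|² L` by the
integrated lapse equation, and `R + n (n - 1) / u²`, which equals `|K⁰|²` by the Hamiltonian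
constraint. -/

noncomputable section

/-! ### Matrices depending on parameters -/

section MatrixCalculus

open Matrix

variable {m 𝕜 : Type*} [Fintype m] [DecidableEq m] [NontriviallyNormedField 𝕜]

section Derivatives

variable {A : 𝕜 → Matrix m m 𝕜} {A' : Matrix m m 𝕜} {s : Set 𝕜} {t : 𝕜}

theorem trace_adjugate_mul_eq_sum_perm (A B : Matrix m m 𝕜) :
    trace (A.adjugate * B) = ∑ σ : Equiv.Perm m, ((Equiv.Perm.sign σ : ℤ) : 𝕜) *
      ∑ i, (∏ j ∈ Finset.univ.erase i, A (σ j) j) • B (σ i) i := by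
  have cramer_expansion :
      trace (A.adjugate * B) = ∑ i, (A.updateCol i fun k => B k i).det := by
    simp only [trace, diag_apply]
    refine Finset.sum_congr rfl fun i _ => ?_
    rw [← cramer_apply, cramer_eq_adjugate_mulVec]
    rfl
  rw [cramer_expansion]
  simp only [det_apply', Finset.mul_sum]
  rw [Finset.sum_comm]
  refine Finset.sum_congr rfl fun σ _ => Finset.sum_congr rfl fun i _ => ?_
  rw [← Finset.mul_prod_erase _ _ (Finset.mem_univ i), updateCol_self, smul_eq_mul,
    mul_comm (B (σ i) i)]
  congr 2
  refine Finset.prod_congr rfl fun j hj => ?_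
  rw [updateCol_ne (Finset.ne_of_mem_erase hj)]

theorem hasDerivWithinAt_det (hA : ∀ i j, HasDerivWithinAt (fun τ => A τ i j) (A' i j) s t) :
    HasDerivWithinAt (fun τ => (A τ).det) (trace ((A t).adjugate * A')) s t := by
  rw [trace_adjugate_mul_eq_sum_perm]
  simp only [det_apply']
  exact HasDerivWithinAt.fun_sum fun σ _ =>
    (HasDerivWithinAt.fun_finsetProd fun i _ => hA (σ i) i).const_mul _

end Derivatives

open scoped Matrix.Norms.Operator in
theorem hasDerivWithinAt_matrix_inv {A : ℝ → Matrix m m ℝ} {A' : Matrix m m ℝ}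
    {s : Set ℝ} {t : ℝ}
    (hA : ∀ i j, HasDerivWithinAt (fun τ => A τ i j) (A' i j) s t) (h0 : (A t).det ≠ 0) (i j : m) :
    HasDerivWithinAt (fun τ => (A τ)⁻¹ i j) ((-((A t)⁻¹ * A' * (A t)⁻¹)) i j) s t := by
  have hA_matrix : HasDerivWithinAt A A' s t :=
    hasDerivWithinAt_pi.2 fun i => hasDerivWithinAt_pi.2 fun j => hA i j
  obtain ⟨u, hu⟩ : IsUnit (A t) := (isUnit_iff_isUnit_det _).2 h0.isUnit
  have hinv := (hu ▸ hasFDerivAt_ringInverse (𝕜 := ℝ) u).comp_hasDerivWithinAt t hA_matrix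
  have hentry := hasDerivWithinAt_pi.1 (hasDerivWithinAt_pi.1 hinv i) j
  simpa [Function.comp_def, ← nonsing_inv_eq_ringInverse, ← hu] using hentry

section ContDiffOn

variable {E : Type*} [NormedAddCommGroup E] [NormedSpace 𝕜 E] {s : Set E} {A : E → Matrix m m 𝕜}
  {N : WithTop ℕ∞}

theorem contDiffOn_det (hA : ∀ i j, ContDiffOn 𝕜 N (fun y => A y i j) s) :
    ContDiffOn 𝕜 N (fun y => (A y).det) s := by
  simp only [det_apply']
  refine ContDiffOn.sum fun σ _ => contDiffOn_const.mul ?_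
  exact contDiffOn_prod fun i _ => hA (σ i) i

theorem contDiffOn_matrix_inv (hA : ∀ i j, ContDiffOn 𝕜 N (fun y => A y i j) s)
    (h0 : ∀ y ∈ s, (A y).det ≠ 0) (i j : m) : ContDiffOn 𝕜 N (fun y => (A y)⁻¹ i j) s := by
  simp only [inv_def, Ring.inverse_eq_inv', Matrix.smul_apply, smul_eq_mul, adjugate_apply]
  refine ((contDiffOn_det hA).inv h0).mul (contDiffOn_det fun a b => ?_)
  obtain rfl | h := eq_or_ne a j
  · simpa only [updateRow_self] using contDiffOn_const
  · simpa only [updateRow_ne h] using hA a b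

end ContDiffOn

theorem adjugate_eq_det_smul_inv {A : Matrix m m 𝕜} (hA : A.det ≠ 0) :
    A.adjugate = A.det • A⁻¹ := by
  rw [inv_def, smul_smul, Ring.inverse_eq_inv', mul_inv_cancel₀ hA, one_smul]

omit [DecidableEq m] in
theorem trace_mul_nonneg {P Q : Matrix m m ℝ} (hP : P.PosSemidef) (hQ : ∀ v, 0 ≤ v ⬝ᵥ Q *ᵥ v) :
    0 ≤ trace (P * Q) := by
  obtain ⟨k, v, rfl⟩ := posSemidef_iff_eq_sum_vecMulVec.1 hP
  simp only [star_trivial, Finset.sum_mul, trace_sum, vecMulVec_mul, trace_vecMulVec]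
  exact Finset.sum_nonneg fun a _ => by
    simpa only [dotProduct_mulVec, dotProduct_comm] using hQ (v a)

end MatrixCalculus

/-! ### Trace and norm with respect to an inner product matrix -/

section MetricTrace

open Matrix

variable {m : Type*} [Fintype m] [DecidableEq m]

/-- The trace `g^ij T_ij` of the 2-tensor `T` with respect to the inner product `g`. -/
def metricTrace (g T : Matrix m m ℝ) : ℝ := trace (g⁻¹ * Tᵀ)

/-- The squared norm `g^ik g^jl T_ij T_kl` of the 2-tensor `T` with respect to the inner
product `g`. -/
def metricNormSq (g T : Matrix m m ℝ) : ℝ := trace (g⁻¹ᵀ * T * g⁻¹ * Tᵀ)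

theorem metricTrace_eq_sum (g T : Matrix m m ℝ) :
    metricTrace g T = ∑ i, ∑ j, g⁻¹ i j * T i j := by
  simp [metricTrace, trace, mul_apply]

theorem metricNormSq_eq_sum (g T : Matrix m m ℝ) :
    metricNormSq g T = ∑ i, ∑ j, ∑ k, ∑ l, g⁻¹ i k * g⁻¹ j l * T i j * T k l := by
  simp only [metricNormSq, trace, diag_apply, mul_apply, transpose_apply, Finset.sum_mul]
  calc _ = ∑ k, ∑ l, ∑ i, ∑ j, g⁻¹ i k * g⁻¹ j l * T i j * T k l := by
        refine Finset.sum_congr rfl fun k _ => Finset.sum_congr rfl fun l _ => ?_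
        rw [Finset.sum_comm]
        refine Finset.sum_congr rfl fun i _ => Finset.sum_congr rfl fun j _ => ?_
        ring
    _ = ∑ k, ∑ i, ∑ l, ∑ j, g⁻¹ i k * g⁻¹ j l * T i j * T k l :=
        Finset.sum_congr rfl fun k _ => Finset.sum_comm
    _ = ∑ i, ∑ k, ∑ l, ∑ j, g⁻¹ i k * g⁻¹ j l * T i j * T k l := Finset.sum_comm
    _ = ∑ i, ∑ k, ∑ j, ∑ l, g⁻¹ i k * g⁻¹ j l * T i j * T k l :=
        Finset.sum_congr rfl fun i _ => Finset.sum_congr rfl fun k _ => Finset.sum_comm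
    _ = _ := Finset.sum_congr rfl fun i _ => Finset.sum_comm

variable {g T J : Matrix m m ℝ}

theorem metricTrace_congruence (hJ : J.det ≠ 0) :
    metricTrace (Jᵀ * g * J) (Jᵀ * T * J) = metricTrace g T := by
  have hJ_inv : J * J⁻¹ = 1 := mul_nonsing_inv _ hJ.isUnit
  have hJt_inv : Jᵀ⁻¹ * Jᵀ = 1 := nonsing_inv_mul _ (by simpa using hJ.isUnit)
  simp only [metricTrace, Matrix.mul_inv_rev, transpose_mul, transpose_transpose]
  calc trace (J⁻¹ * (g⁻¹ * Jᵀ⁻¹) * (Jᵀ * (Tᵀ * J)))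
      = trace (J⁻¹ * (g⁻¹ * (Jᵀ⁻¹ * Jᵀ) * Tᵀ * J)) := by simp only [mul_assoc]
    _ = trace (g⁻¹ * Tᵀ) := by
        rw [hJt_inv, mul_one, trace_mul_comm, mul_assoc, hJ_inv, mul_one]

theorem metricNormSq_congruence (hJ : J.det ≠ 0) :
    metricNormSq (Jᵀ * g * J) (Jᵀ * T * J) = metricNormSq g T := by
  have hJ_inv : J * J⁻¹ = 1 := mul_nonsing_inv _ hJ.isUnit
  have hJt_inv : J⁻¹ᵀ * Jᵀ = 1 := by rw [← transpose_mul, hJ_inv, transpose_one]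
  simp only [metricNormSq, Matrix.mul_inv_rev, transpose_mul, transpose_transpose]
  rw [← transpose_nonsing_inv J, transpose_transpose]
  calc trace (J⁻¹ * g⁻¹ᵀ * J⁻¹ᵀ * (Jᵀ * T * J) * (J⁻¹ * (g⁻¹ * J⁻¹ᵀ)) * (Jᵀ * (Tᵀ * J)))
      = trace (J⁻¹ * (g⁻¹ᵀ * (J⁻¹ᵀ * Jᵀ) * T * (J * J⁻¹) * g⁻¹ * (J⁻¹ᵀ * Jᵀ) * Tᵀ * J)) := by
        simp only [mul_assoc]
    _ = _ := by
        rw [hJt_inv, hJ_inv, trace_mul_comm, mul_assoc _ J, hJ_inv]; simp only [mul_one]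

theorem dotProduct_inv_mulVec_congruence (hJ : J.det ≠ 0) (a b : m → ℝ) :
    (Jᵀ *ᵥ a) ⬝ᵥ (Jᵀ * g * J)⁻¹ *ᵥ (Jᵀ *ᵥ b) = a ⬝ᵥ g⁻¹ *ᵥ b := by
  have hJ_inv : J * J⁻¹ = 1 := mul_nonsing_inv _ hJ.isUnit
  have hJt_inv : Jᵀ⁻¹ * Jᵀ = 1 := nonsing_inv_mul _ (by simpa using hJ.isUnit)
  rw [mulVec_transpose, ← dotProduct_mulVec, mulVec_mulVec, mulVec_mulVec, Matrix.mul_inv_rev,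
    Matrix.mul_inv_rev]
  congr 2
  calc J * (J⁻¹ * (g⁻¹ * Jᵀ⁻¹)) * Jᵀ = J * J⁻¹ * g⁻¹ * (Jᵀ⁻¹ * Jᵀ) := by simp only [mul_assoc]
    _ = g⁻¹ := by rw [hJ_inv, hJt_inv, one_mul, mul_one]

theorem metricNormSq_nonneg (hg : g.PosDef) : 0 ≤ metricNormSq g T := by
  have hP : g⁻¹ᵀ.PosSemidef := hg.inv.posSemidef.transpose
  rw [metricNormSq, mul_assoc, mul_assoc]
  refine trace_mul_nonneg hP fun v => ?_
  have := hg.inv.posSemidef.dotProduct_mulVec_nonneg (Tᵀ *ᵥ v)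
  rwa [star_trivial, mulVec_transpose, ← dotProduct_mulVec, ← mulVec_transpose, mulVec_mulVec,
    mulVec_mulVec, mul_assoc] at this

end MetricTrace

/-! ### Components of tensor fields in charts -/

section Components

open Matrix

variable {n : ℕ} {X : Type*} [TopologicalSpace X] [ChartedSpace (Coord n) X]

/-- The matrix of a 2-tensor field at `x` in the standard basis of `TangentSpace (𝓡 n) x`, which is
the coordinate basis of the preferred chart at `x`. -/
def TwoTensor.mat (T : TwoTensor n X) (x : X) : Matrix (Fin n) (Fin n) ℝ :=
  of fun i j => T x (EuclideanSpace.single i 1 : Coord n) (EuclideanSpace.single j 1 : Coord n)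

/-- The derivative of the inverse of a chart, as an endomorphism of the model space. -/
def chartDeriv (c : OpenPartialHomeomorph X (Coord n)) (y : Coord n) : Coord n →L[ℝ] Coord n :=
  mfderiv (𝓡 n) (𝓡 n) c.symm y

/-- The matrix whose columns are the coordinate vectors of the chart `c`. -/
def coordMatrix (c : OpenPartialHomeomorph X (Coord n)) (y : Coord n) :
    Matrix (Fin n) (Fin n) ℝ :=
  LinearMap.toMatrix (EuclideanSpace.basisFun (Fin n) ℝ).toBasis
    (EuclideanSpace.basisFun (Fin n) ℝ).toBasis (chartDeriv c y)

theorem TwoTensor.apply_eq_dotProduct (T : TwoTensor n X) (x : X) (v w : Coord n) :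
    T x v w = v.ofLp ⬝ᵥ T.mat x *ᵥ w.ofLp := by
  let B : Coord n →L[ℝ] Coord n →L[ℝ] ℝ := T x
  have expand (v : Coord n) : v = ∑ i, v i • (EuclideanSpace.single i 1 : Coord n) := by
    simpa using ((EuclideanSpace.basisFun (Fin n) ℝ).sum_repr v).symm
  have hB : B v w = ∑ i, ∑ j, v i * (B (EuclideanSpace.single i 1) (EuclideanSpace.single j 1) *
      w j) := by
    conv_lhs => rw [expand v, expand w]
    simp only [map_sum, map_smul, _root_.sum_apply, _root_.smul_apply, smul_eq_mul, Finset.mul_sum]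
    rw [Finset.sum_comm]
    refine Finset.sum_congr rfl fun i _ => Finset.sum_congr rfl fun j _ => ?_
    ring
  exact hB.trans (by simp only [dotProduct, mulVec, Finset.mul_sum]; rfl)

theorem coordMatrix_apply (c : OpenPartialHomeomorph X (Coord n)) (y : Coord n) (i j : Fin n) :
    coordMatrix c y i j = chartDeriv c y (EuclideanSpace.single j 1) i := by
  simp [LinearMap.toMatrix_apply, coordMatrix]

theorem TwoTensor.comp_eq (T : TwoTensor n X) (c : OpenPartialHomeomorph X (Coord n))
    (y : Coord n) :
    T.comp c y = (coordMatrix c y)ᵀ * T.mat (c.symm y) * coordMatrix c y := by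
  ext i j
  refine (T.apply_eq_dotProduct (c.symm y) (chartDeriv c y (EuclideanSpace.single i 1))
    (chartDeriv c y (EuclideanSpace.single j 1))).trans ?_
  rw [Matrix.mul_assoc]
  simp only [mul_apply, transpose_apply, coordMatrix_apply, dotProduct, mulVec]

theorem coordMatrix_det (c : OpenPartialHomeomorph X (Coord n)) (y : Coord n) :
    (coordMatrix c y).det = (chartDeriv c y).det := by
  rw [coordMatrix, LinearMap.det_toMatrix]

theorem CoordTensor.trace_eq_metricTrace (G T : CoordTensor n) (y : Coord n) :
    CoordTensor.trace G T y = metricTrace (G y) (T y) :=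
  (metricTrace_eq_sum _ _).symm

theorem CoordTensor.normSq_eq_metricNormSq (G T : CoordTensor n) (y : Coord n) :
    CoordTensor.normSq G T y = metricNormSq (G y) (T y) :=
  (metricNormSq_eq_sum _ _).symm

/-- A smooth Riemannian metric, with smoothness expressed through its components in charts. -/
structure TwoTensor.IsRiemannian (h : TwoTensor n X) : Prop where
  symm : ∀ x v w, h x v w = h x w v
  pos : ∀ x v, v ≠ 0 → 0 < h x v v
  smooth : ∀ c ∈ atlas (Coord n) X, ∀ i j, ContDiffOn ℝ ∞ (fun y => h.comp c y i j) c.target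

variable {h K : TwoTensor n X} {x : X}

theorem TwoTensor.IsRiemannian.mat_posDef (hh : h.IsRiemannian) (x : X) : (h.mat x).PosDef := by
  refine PosDef.of_dotProduct_mulVec_pos (by ext i j; exact hh.symm x _ _) fun v hv => ?_
  have hv' : WithLp.toLp 2 v ≠ 0 := by simpa using hv
  exact (hh.pos x (WithLp.toLp 2 v : Coord n) hv').trans_eq (h.apply_eq_dotProduct x _ _)

variable [IsManifold (𝓡 n) ∞ X] {c c' : OpenPartialHomeomorph X (Coord n)} {y : Coord n}

theorem mdifferentiable_of_mem_smooth_atlas (hc : c ∈ atlas (Coord n) X) :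
    c.MDifferentiable (𝓡 n) (𝓡 n) :=
  haveI : IsManifold (𝓡 n) 1 X := IsManifold.of_le (n := ∞) (by norm_num)
  mdifferentiable_of_mem_atlas hc

theorem chartDeriv_injective (hc : c ∈ atlas (Coord n) X) (hy : y ∈ c.target) :
    Function.Injective (chartDeriv c y) :=
  (mdifferentiable_of_mem_smooth_atlas hc).symm.mfderiv_injective hy

theorem coordMatrix_det_ne_zero (hc : c ∈ atlas (Coord n) X) (hy : y ∈ c.target) :
    (coordMatrix c y).det ≠ 0 := by
  rw [coordMatrix_det]
  exact (LinearMap.isUnit_det _ <| (LinearMap.isUnit_iff_ker_eq_bot _).2 <|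
    LinearMap.ker_eq_bot.2 (chartDeriv_injective hc hy)).ne_zero

theorem TwoTensor.IsRiemannian.comp_posDef (hh : h.IsRiemannian) (hc : c ∈ atlas (Coord n) X)
    (hy : y ∈ c.target) : (h.comp c y).PosDef := by
  have hJ : IsUnit (coordMatrix c y) :=
    (isUnit_iff_isUnit_det _).2 (coordMatrix_det_ne_zero hc hy).isUnit
  have := (hh.mat_posDef (c.symm y)).conjTranspose_mul_mul_same (mulVec_injective_of_isUnit hJ)
  rwa [conjTranspose_eq_transpose_of_trivial, ← h.comp_eq] at this

theorem trace_comp_eq_metricTrace (hc : c ∈ atlas (Coord n) X) (hy : y ∈ c.target) :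
    CoordTensor.trace (h.comp c) (K.comp c) y =
      metricTrace (h.mat (c.symm y)) (K.mat (c.symm y)) := by
  rw [CoordTensor.trace_eq_metricTrace, h.comp_eq, K.comp_eq,
    metricTrace_congruence (coordMatrix_det_ne_zero hc hy)]

theorem trace_comp_eq_trace (hc : c ∈ atlas (Coord n) X) (hy : y ∈ c.target) :
    CoordTensor.trace (h.comp c) (K.comp c) y = h.trace K (c.symm y) := by
  rw [trace_comp_eq_metricTrace hc hy, TwoTensor.trace,
    trace_comp_eq_metricTrace (chart_mem_atlas _ _) (mem_chart_target _ _),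
    OpenPartialHomeomorph.left_inv _ (mem_chart_source _ _)]

theorem normSq_traceFree_comp_eq_metricNormSq (hc : c ∈ atlas (Coord n) X) (hy : y ∈ c.target) :
    CoordTensor.normSq (h.comp c) (CoordTensor.traceFree (h.comp c) (K.comp c)) y =
      metricNormSq (h.mat (c.symm y)) (K.mat (c.symm y) -
        (metricTrace (h.mat (c.symm y)) (K.mat (c.symm y)) / n) • h.mat (c.symm y)) := by
  rw [CoordTensor.normSq_eq_metricNormSq, CoordTensor.traceFree, trace_comp_eq_metricTrace hc hy,
    h.comp_eq, K.comp_eq, ← metricNormSq_congruence (g := h.mat (c.symm y))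
    (coordMatrix_det_ne_zero hc hy)]
  simp only [mul_sub, sub_mul, Matrix.mul_smul, Matrix.smul_mul]

theorem traceFreeNormSq_eq_metricNormSq (h K : TwoTensor n X) (x : X) :
    h.traceFreeNormSq K x =
      metricNormSq (h.mat x) (K.mat x - (metricTrace (h.mat x) (K.mat x) / n) • h.mat x) := by
  rw [TwoTensor.traceFreeNormSq, normSq_traceFree_comp_eq_metricNormSq (chart_mem_atlas _ _)
    (mem_chart_target _ _), OpenPartialHomeomorph.left_inv _ (mem_chart_source _ _)]

theorem normSq_traceFree_comp_eq_traceFreeNormSq (hc : c ∈ atlas (Coord n) X)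
    (hy : y ∈ c.target) :
    CoordTensor.normSq (h.comp c) (CoordTensor.traceFree (h.comp c) (K.comp c)) y =
      h.traceFreeNormSq K (c.symm y) := by
  rw [normSq_traceFree_comp_eq_metricNormSq hc hy, traceFreeNormSq_eq_metricNormSq]

theorem TwoTensor.IsRiemannian.traceFreeNormSq_nonneg (hh : h.IsRiemannian) :
    0 ≤ h.traceFreeNormSq K x := by
  rw [traceFreeNormSq_eq_metricNormSq]
  exact metricNormSq_nonneg (hh.mat_posDef x)

theorem differentiableAt_transition (hc : c ∈ atlas (Coord n) X) (hc' : c' ∈ atlas (Coord n) X)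
    (hy : y ∈ c'.target) (hy' : c'.symm y ∈ c.source) :
    DifferentiableAt ℝ (c ∘ c'.symm) y :=
  mdifferentiableAt_iff_differentiableAt.1 <|
    ((mdifferentiable_of_mem_smooth_atlas hc).mdifferentiableAt hy').comp y
      ((mdifferentiable_of_mem_smooth_atlas hc').mdifferentiableAt_symm hy)

theorem chartDeriv_transition (hc : c ∈ atlas (Coord n) X) (hc' : c' ∈ atlas (Coord n) X)
    (hy : y ∈ c'.target) (hy' : c'.symm y ∈ c.source) :
    chartDeriv c' y = (chartDeriv c (c (c'.symm y))).comp (fderiv ℝ (c ∘ c'.symm) y) := by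
  have factor : c'.symm =ᶠ[𝓝 y] c.symm ∘ (c ∘ c'.symm) := by
    filter_upwards [(c'.continuousAt_symm hy).eventually (c.open_source.mem_nhds hy')] with z hz
    exact (c.left_inv hz).symm
  have chain := mfderiv_comp (I := 𝓡 n) (I' := 𝓡 n) (I'' := 𝓡 n) y
    ((mdifferentiable_of_mem_smooth_atlas hc).mdifferentiableAt_symm (c.map_source hy') :
      MDifferentiableAt (𝓡 n) (𝓡 n) c.symm ((c ∘ c'.symm) y))
    (mdifferentiableAt_iff_differentiableAt.2 (differentiableAt_transition hc hc' hy hy'))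
  rw [mfderiv_eq_fderiv] at chain
  exact factor.mfderiv_eq.trans chain

end Components

/-! ### Continuity in charts -/

section ContinuityInCharts

variable {n : ℕ} {X T Z : Type*} [TopologicalSpace X] [ChartedSpace (Coord n) X]
  [TopologicalSpace T] [TopologicalSpace Z] {I : Set T}

theorem continuousOn_of_charts {φ : T → X → Z}
    (hφ : ∀ c ∈ atlas (Coord n) X,
      ContinuousOn (fun p : T × Coord n => φ p.1 (c.symm p.2)) (I ×ˢ c.target)) :
    ContinuousOn (fun p : T × X => φ p.1 p.2) (I ×ˢ univ) := by
  rintro ⟨t, x⟩ ⟨ht, -⟩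
  set c := chartAt (Coord n) x
  have hx : x ∈ c.source := mem_chart_source _ x
  have on_source : ContinuousOn (fun p : T × X => φ p.1 p.2) (I ×ˢ c.source) := by
    refine ((hφ c (chart_mem_atlas _ _)).comp (f := fun p : T × X => (p.1, c p.2)) ?_
      fun p hp => ⟨hp.1, c.map_source hp.2⟩).congr fun p hp => ?_
    · exact continuousOn_fst.prodMk (c.continuousOn.comp continuousOn_snd fun p hp => hp.2)
    · simp [c.left_inv hp.2]
  refine (on_source (t, x) ⟨ht, hx⟩).mono_of_mem_nhdsWithin (mem_nhdsWithin.2 ?_)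
  exact ⟨univ ×ˢ c.source, isOpen_univ.prod c.open_source, ⟨trivial, hx⟩,
    fun p hp => ⟨hp.2.1, hp.1.2⟩⟩

omit [ChartedSpace (Coord n) X] in
theorem continuous_slice {φ : T → X → Z}
    (hφ : ContinuousOn (fun p : T × X => φ p.1 p.2) (I ×ˢ univ)) {t : T} (ht : t ∈ I) :
    Continuous (φ t) :=
  continuousOn_univ.1 (hφ.comp (f := fun x : X => (t, x)) (by fun_prop) fun _ _ => ⟨ht, trivial⟩)

theorem continuous_of_charts {f : X → Z}
    (hf : ∀ c ∈ atlas (Coord n) X, ContinuousOn (fun y => f (c.symm y)) c.target) :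
    Continuous f :=
  continuous_slice (φ := fun _ : Unit => f) (continuousOn_of_charts (φ := fun _ => f) fun c hc =>
    (hf c hc).comp continuousOn_snd fun _ (hp : _ ∈ univ ×ˢ _) => hp.2) (mem_univ ())

end ContinuityInCharts

/-! ### The Riemannian volume -/

section Volume

variable {n : ℕ} {X : Type*} [TopologicalSpace X] [ChartedSpace (Coord n) X]
  {h h' : TwoTensor n X} {c c' : OpenPartialHomeomorph X (Coord n)} {y : Coord n}

theorem TwoTensor.sqrt_det_comp (h : TwoTensor n X) (c : OpenPartialHomeomorph X (Coord n))
    (y : Coord n) :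
    √(h.comp c y).det = |(chartDeriv c y).det| * √(h.mat (c.symm y)).det := by
  rw [h.comp_eq, Matrix.det_mul, Matrix.det_mul, Matrix.det_transpose, coordMatrix_det,
    mul_right_comm, Real.sqrt_mul (mul_self_nonneg _), Real.sqrt_mul_self_eq_abs]

/-- The density of the Riemannian measure of `h'` with respect to that of `h`. -/
def TwoTensor.volumeRatio (h h' : TwoTensor n X) (x : X) : ℝ :=
  √((h'.mat x).det / (h.mat x).det)

theorem TwoTensor.IsRiemannian.volumeRatio_pos (hh : h.IsRiemannian) (hh' : h'.IsRiemannian)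
    (x : X) : 0 < h.volumeRatio h' x :=
  Real.sqrt_pos.2 (div_pos (hh'.mat_posDef x).det_pos (hh.mat_posDef x).det_pos)

section Measurability

variable [MeasurableSpace X] [BorelSpace X]

omit [ChartedSpace (Coord n) X] in
theorem measurableSet_target_inter_preimage (c : OpenPartialHomeomorph X (Coord n)) {A : Set X}
    (hA : MeasurableSet A) : MeasurableSet (c.target ∩ c.symm ⁻¹' A) := by
  have h_subtype : MeasurableSet ((fun y : c.target => c.symm y) ⁻¹' A) :=
    (continuousOn_iff_continuous_domRestrict.1 c.continuousOn_symm).measurable hA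
  convert c.open_target.measurableSet.subtype_image h_subtype using 1
  ext y
  simp [and_comm]

omit [ChartedSpace (Coord n) X] in
theorem aemeasurable_chart_symm (c : OpenPartialHomeomorph X (Coord n)) (f : Coord n → ℝ≥0∞) :
    AEMeasurable c.symm ((volume.restrict c.target).withDensity f) :=
  (c.continuousOn_symm.aemeasurable c.open_target.measurableSet).mono_ac
    (withDensity_absolutelyContinuous _ _)

theorem chartVolume_apply (h : TwoTensor n X) (c : OpenPartialHomeomorph X (Coord n)) {A : Set X}
    (hA : MeasurableSet A) :
    h.chartVolume c A = ∫⁻ y in c.target ∩ c.symm ⁻¹' A, ENNReal.ofReal √(h.comp c y).det := by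
  rw [TwoTensor.chartVolume, Measure.map_apply_of_aemeasurable (aemeasurable_chart_symm c _) hA,
    withDensity_apply', Measure.restrict_restrict' c.open_target.measurableSet, inter_comm]

theorem chartVolume_restrict_source (h : TwoTensor n X) (c : OpenPartialHomeomorph X (Coord n)) :
    (h.chartVolume c).restrict c.source = h.chartVolume c := by
  ext A hA
  rw [Measure.restrict_apply hA, chartVolume_apply h c hA,
    chartVolume_apply h c (hA.inter c.open_source.measurableSet)]
  congr 2
  ext y
  simp only [mem_inter_iff, mem_preimage]
  exact ⟨fun hy => ⟨hy.1, hy.2.1⟩, fun hy => ⟨hy.1, hy.2, c.map_target hy.1⟩⟩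

end Measurability

omit [ChartedSpace (Coord n) X] in
theorem transition_image (c c' : OpenPartialHomeomorph X (Coord n)) (A : Set X) :
    (c ∘ c'.symm) '' (c'.target ∩ c'.symm ⁻¹' (A ∩ c.source)) =
      c.target ∩ c.symm ⁻¹' (A ∩ c'.source) := by
  ext y
  constructor
  · rintro ⟨z, ⟨hz, hzA, hzc⟩, rfl⟩
    refine ⟨c.map_source hzc, ?_⟩
    simpa only [mem_preimage, Function.comp_apply, c.left_inv hzc] using ⟨hzA, c'.map_target hz⟩
  · rintro ⟨hy, hyA, hy'⟩
    refine ⟨c' (c.symm y), ⟨c'.map_source hy', ?_⟩, ?_⟩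
    · simpa only [mem_preimage, c'.left_inv hy'] using ⟨hyA, c.map_target hy⟩
    · rw [Function.comp_apply, c'.left_inv hy', c.right_inv hy]

variable [IsManifold (𝓡 n) ∞ X]

theorem TwoTensor.IsRiemannian.det_pos (hh : h.IsRiemannian) (hc : c ∈ atlas (Coord n) X)
    (hy : y ∈ c.target) : 0 < (h.comp c y).det :=
  (hh.comp_posDef hc hy).det_pos

theorem TwoTensor.IsRiemannian.contDiffOn_sqrt_det (hh : h.IsRiemannian)
    (hc : c ∈ atlas (Coord n) X) : ContDiffOn ℝ ∞ (fun y => √(h.comp c y).det) c.target :=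
  (contDiffOn_det (hh.smooth c hc)).sqrt fun _ hy => (hh.det_pos hc hy).ne'

theorem TwoTensor.IsRiemannian.aemeasurable_sqrt_det (hh : h.IsRiemannian)
    (hc : c ∈ atlas (Coord n) X) :
    AEMeasurable (fun y => ENNReal.ofReal √(h.comp c y).det) (volume.restrict c.target) :=
  ((hh.contDiffOn_sqrt_det hc).continuousOn.aemeasurable
    c.open_target.measurableSet).ennreal_ofReal

theorem volumeRatio_chart (h h' : TwoTensor n X) (hc : c ∈ atlas (Coord n) X)
    (hy : y ∈ c.target) :
    h.volumeRatio h' (c.symm y) = √((h'.comp c y).det / (h.comp c y).det) := by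
  have hJ := coordMatrix_det_ne_zero hc hy
  simp only [TwoTensor.volumeRatio, TwoTensor.comp_eq, Matrix.det_mul, Matrix.det_transpose,
    mul_right_comm (coordMatrix c y).det]
  rw [mul_div_mul_left _ _ (mul_ne_zero hJ hJ)]

theorem TwoTensor.IsRiemannian.continuous_volumeRatio (hh : h.IsRiemannian)
    (hh' : h'.IsRiemannian) : Continuous (h.volumeRatio h') :=
  continuous_of_charts (n := n) fun c hc => ContinuousOn.congr
    (((contDiffOn_det (hh'.smooth c hc)).continuousOn.div
      (contDiffOn_det (hh.smooth c hc)).continuousOn fun _ hy => (hh.det_pos hc hy).ne').sqrt)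
    fun _ hy => volumeRatio_chart h h' hc hy

variable [MeasurableSpace X] [BorelSpace X]

theorem chartVolume_restrict_comm (h : TwoTensor n X) (hc : c ∈ atlas (Coord n) X)
    (hc' : c' ∈ atlas (Coord n) X) :
    (h.chartVolume c').restrict c.source = (h.chartVolume c).restrict c'.source := by
  ext A hA
  have hAc := hA.inter c.open_source.measurableSet
  have hAc' := hA.inter c'.open_source.measurableSet
  rw [Measure.restrict_apply hA, Measure.restrict_apply hA, chartVolume_apply h c' hAc,
    chartVolume_apply h c hAc', ← transition_image c c' A]
  set S := c'.target ∩ c'.symm ⁻¹' (A ∩ c.source)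
  have hS : MeasurableSet S := measurableSet_target_inter_preimage c' hAc
  have hderiv : ∀ z ∈ S, HasFDerivWithinAt (c ∘ c'.symm) (fderiv ℝ (c ∘ c'.symm) z) S z :=
    fun z hz => (differentiableAt_transition hc hc' hz.1 hz.2.2).hasFDerivAt.hasFDerivWithinAt
  have hinj : InjOn (c ∘ c'.symm) S := fun z hz w hw hzw =>
    c'.symm.injOn hz.1 hw.1 (c.injOn hz.2.2 hw.2.2 hzw)
  rw [lintegral_image_eq_lintegral_abs_det_fderiv_mul volume hS hderiv hinj]
  refine setLIntegral_congr_fun hS fun z hz => ?_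
  rw [← ENNReal.ofReal_mul (abs_nonneg _), h.sqrt_det_comp, h.sqrt_det_comp,
    chartDeriv_transition hc hc' hz.1 hz.2.2, Function.comp_apply, c.left_inv hz.2.2,
    ContinuousLinearMap.det, ContinuousLinearMap.toLinearMap_comp, LinearMap.det_comp, abs_mul,
    mul_comm |LinearMap.det _|, mul_assoc]

theorem volumeMeasure_restrict_source (h : TwoTensor n X) (hc : c ∈ atlas (Coord n) X) :
    h.volumeMeasure.restrict c.source = h.chartVolume c := by
  apply le_antisymm
  · have hle : h.volumeMeasure ≤ h.chartVolume c + h.volumeMeasure.restrict c.sourceᶜ := by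
      refine iSup₂_le fun c' hc' => ?_
      rw [← Measure.restrict_add_restrict_compl (μ := h.chartVolume c')
        c.open_source.measurableSet, chartVolume_restrict_comm h hc hc']
      exact add_le_add Measure.restrict_le_self
        (Measure.restrict_mono le_rfl (le_iSup₂_of_le c' hc' le_rfl))
    refine (Measure.restrict_mono le_rfl hle).trans ?_
    rw [Measure.restrict_add, Measure.restrict_restrict c.open_source.measurableSet,
      inter_compl_self, Measure.restrict_empty, add_zero, chartVolume_restrict_source]
  · rw [← chartVolume_restrict_source]
    exact Measure.restrict_mono le_rfl (le_iSup₂_of_le c hc le_rfl)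

theorem setLIntegral_chartVolume (hh : h.IsRiemannian) (hc : c ∈ atlas (Coord n) X)
    {f : X → ℝ≥0∞} (hf : Measurable f) {A : Set X} (hA : MeasurableSet A) :
    ∫⁻ x in A, f x ∂(h.chartVolume c) = ∫⁻ y in c.target ∩ c.symm ⁻¹' A,
      ENNReal.ofReal √(h.comp c y).det * f (c.symm y) := by
  have hsymm := c.continuousOn_symm.aemeasurable (μ := volume) c.open_target.measurableSet
  rw [TwoTensor.chartVolume, Measure.restrict_map_of_aemeasurable (aemeasurable_chart_symm c _) hA,
    lintegral_map' hf.aemeasurable (aemeasurable_chart_symm c _).restrict, restrict_withDensity',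
    inter_comm, ← Measure.restrict_restrict' c.open_target.measurableSet]
  exact lintegral_withDensity_eq_lintegral_mul₀' (hh.aemeasurable_sqrt_det hc).restrict
    ((hf.comp_aemeasurable hsymm.restrict).mono_ac (withDensity_absolutelyContinuous _ _))

theorem TwoTensor.IsRiemannian.isLocallyFiniteMeasure (hh : h.IsRiemannian) :
    IsLocallyFiniteMeasure h.volumeMeasure := by
  refine ⟨fun x => ?_⟩
  set c := chartAt (Coord n) x
  have hc : c ∈ atlas (Coord n) X := chart_mem_atlas _ _
  obtain ⟨K, hKc, hKx, hKt⟩ : ∃ K, IsCompact K ∧ c x ∈ interior K ∧ K ⊆ c.target :=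
    exists_compact_subset c.open_target (mem_chart_target _ x)
  set U := c.source ∩ c ⁻¹' interior K
  have hU : IsOpen U := c.continuousOn.isOpen_inter_preimage c.open_source isOpen_interior
  refine ⟨U, hU.mem_nhds ⟨mem_chart_source _ x, hKx⟩, ?_⟩
  have hU_chart : h.volumeMeasure U = h.chartVolume c U := by
    rw [← volumeMeasure_restrict_source h hc, Measure.restrict_apply hU.measurableSet,
      inter_eq_left.2 inter_subset_left]
  have hU_coord : c.target ∩ c.symm ⁻¹' U ⊆ K := by
    rintro y ⟨hy, -, hyK⟩
    simpa only [mem_preimage, c.right_inv hy] using interior_subset hyK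
  rw [hU_chart, chartVolume_apply h c hU.measurableSet]
  exact (lintegral_mono_set hU_coord).trans_lt
    (((hh.contDiffOn_sqrt_det hc).continuousOn.mono hKt).integrableOn_compact hKc).lintegral_lt_top

theorem setIntegral_source_eq (hh : h.IsRiemannian) (hc : c ∈ atlas (Coord n) X) {f : X → ℝ}
    (hf : AEStronglyMeasurable f (h.volumeMeasure.restrict c.source)) :
    ∫ x in c.source, f x ∂h.volumeMeasure = ∫ y in c.target, √(h.comp c y).det * f (c.symm y) := by
  rw [volumeMeasure_restrict_source h hc, TwoTensor.chartVolume] at hf ⊢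
  rw [integral_map (aemeasurable_chart_symm c _) hf,
    integral_withDensity_eq_integral_toReal_smul₀ (hh.aemeasurable_sqrt_det hc)
      (ae_of_all _ fun _ => ENNReal.ofReal_lt_top)]
  simp only [ENNReal.toReal_ofReal (Real.sqrt_nonneg _), smul_eq_mul]

omit [IsManifold (𝓡 n) ∞ X] [BorelSpace X] in
theorem measure_ext_of_chart_restrict [SigmaCompactSpace X] {μ ν : Measure X}
    (H : ∀ c ∈ atlas (Coord n) X, μ.restrict c.source = ν.restrict c.source) : μ = ν := by
  obtain ⟨s, hs, hcov⟩ := countable_cover_nhds_of_sigmaCompact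
    (f := fun x : X => (chartAt (Coord n) x).source) fun x => chart_source_mem_nhds _ x
  exact Measure.ext_of_biUnion_eq_univ hs hcov fun x _ => H _ (chart_mem_atlas _ x)

theorem volumeMeasure_eq_withDensity [SigmaCompactSpace X] (hh : h.IsRiemannian)
    (hh' : h'.IsRiemannian) :
    h'.volumeMeasure =
      h.volumeMeasure.withDensity fun x => ENNReal.ofReal (h.volumeRatio h' x) := by
  refine measure_ext_of_chart_restrict (n := n) fun c hc => ?_
  have hm := (hh.continuous_volumeRatio hh').measurable
  rw [restrict_withDensity c.open_source.measurableSet, volumeMeasure_restrict_source h hc,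
    volumeMeasure_restrict_source h' hc]
  ext A hA
  rw [withDensity_apply _ hA, setLIntegral_chartVolume hh hc hm.ennreal_ofReal hA,
    chartVolume_apply h' c hA]
  refine setLIntegral_congr_fun (measurableSet_target_inter_preimage c hA) fun y hy => ?_
  have hdet := hh.det_pos hc hy.1
  rw [← ENNReal.ofReal_mul (Real.sqrt_nonneg _), volumeRatio_chart h h' hc hy.1,
    ← Real.sqrt_mul hdet.le, mul_div_cancel₀ _ hdet.ne']

end Volume

/-! ### The Laplacian in coordinates -/

namespace CoordTensor

open Matrix

variable {n : ℕ} {U : Set (Coord n)} {f g ψ : Coord n → ℝ} {y : Coord n} {G : CoordTensor n}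

theorem contDiffOn_pderiv (hU : IsOpen U) (hf : ContDiffOn ℝ ∞ f U) (k : Fin n) :
    ContDiffOn ℝ ∞ (pderiv k f) U :=
  (hf.fderiv_of_isOpen hU (m := ∞) (by norm_num)).clm_apply contDiffOn_const

theorem differentiableAt_of_contDiffOn (hU : IsOpen U) (hf : ContDiffOn ℝ ∞ f U) (hy : y ∈ U) :
    DifferentiableAt ℝ f y :=
  (hf.contDiffAt (hU.mem_nhds hy)).differentiableAt (by norm_num)

theorem fderiv_eq_sum_pderiv (f : Coord n → ℝ) (y v : Coord n) :
    fderiv ℝ f y v = ∑ i, v i * pderiv i f y := by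
  conv_lhs => rw [← (EuclideanSpace.basisFun (Fin n) ℝ).sum_repr v]
  simp [pderiv]

theorem hasDerivAt_line (hf : DifferentiableAt ℝ f y) (v : Coord n) :
    HasDerivAt (fun σ : ℝ => f (y + σ • v)) (fderiv ℝ f y v) 0 := by
  simpa only [HasLineDerivAt] using hf.hasFDerivAt.hasLineDerivAt v

theorem pderiv_congr (h : f =ᶠ[𝓝 y] g) (k : Fin n) : pderiv k f y = pderiv k g y := by
  rw [pderiv, h.fderiv_eq, pderiv]

theorem pderiv_mul (hf : DifferentiableAt ℝ f y) (hg : DifferentiableAt ℝ g y) (k : Fin n) :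
    pderiv k (fun z => f z * g z) y = f y * pderiv k g y + pderiv k f y * g y := by
  simp only [pderiv, fderiv_fun_mul hf hg, _root_.add_apply, _root_.smul_apply, smul_eq_mul,
    mul_comm (g y)]

theorem pderiv_sum {ι : Type*} {s : Finset ι} {F : ι → Coord n → ℝ}
    (hF : ∀ a ∈ s, DifferentiableAt ℝ (F a) y) (k : Fin n) :
    pderiv k (fun z => ∑ a ∈ s, F a z) y = ∑ a ∈ s, pderiv k (F a) y := by
  simp only [pderiv, fderiv_fun_sum hF, _root_.sum_apply]

/-- The matrix of the coordinate derivatives `∂_k h_ij` of a metric. -/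
def metricDeriv (G : CoordTensor n) (k : Fin n) (y : Coord n) : Matrix (Fin n) (Fin n) ℝ :=
  of fun i j => pderiv k (fun z => G z i j) y

/-- The trace of the Hessian, `h^ij f_{;ij}`. -/
def laplacian (G : CoordTensor n) (f : Coord n → ℝ) (y : Coord n) : ℝ :=
  ∑ i, ∑ j, (G y)⁻¹ i j * hessian G f i j y

/-- The inner product of gradients, `h^ij ∂_i f ∂_j g`. -/
def gradInner (G : CoordTensor n) (f g : Coord n → ℝ) (y : Coord n) : ℝ :=
  (pderiv · f y) ⬝ᵥ (G y)⁻¹ *ᵥ (pderiv · g y)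

/-- The vector density `√(det h) h^ij ∂_j f`, whose coordinate divergence is `√(det h) Δf`. -/
def gradDensity (G : CoordTensor n) (f : Coord n → ℝ) (i : Fin n) (y : Coord n) : ℝ :=
  √(G y).det * ∑ j, (G y)⁻¹ i j * pderiv j f y

theorem sum_pderiv_mul_gradDensity (G : CoordTensor n) (f g : Coord n → ℝ) (y : Coord n) :
    ∑ i, pderiv i f y * gradDensity G g i y = √(G y).det * gradInner G f g y := by
  simp only [gradInner, gradDensity, dotProduct, mulVec, Finset.mul_sum]
  exact Finset.sum_congr rfl fun i _ => Finset.sum_congr rfl fun j _ => by ring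

theorem contracted_christoffel (hG : (G y)⁻¹.IsSymm) (hD : ∀ k, (metricDeriv G k y).IsSymm)
    (j : Fin n) :
    ∑ i, ((1 / 2) * Matrix.trace ((G y)⁻¹ * metricDeriv G i y) * (G y)⁻¹ i j
        - ((G y)⁻¹ * metricDeriv G i y * (G y)⁻¹) i j) =
      -∑ i, ∑ k, (G y)⁻¹ i k * christoffel G j i k y := by
  set P := (G y)⁻¹
  set D := fun k => metricDeriv G k y
  have first_term : ∑ i, (P * D i * P) i j = ∑ i, ∑ k, ∑ l, P i k * P j l * D i k l := by
    refine Finset.sum_congr rfl fun i _ => ?_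
    simp only [mul_apply, Finset.sum_mul]
    rw [Finset.sum_comm]
    refine Finset.sum_congr rfl fun k _ => Finset.sum_congr rfl fun l _ => ?_
    rw [hG.apply j l]
    ring
  have second_term :
      ∑ i, ∑ k, ∑ l, P i k * P j l * D k i l = ∑ i, ∑ k, ∑ l, P i k * P j l * D i k l := by
    rw [Finset.sum_comm]
    refine Finset.sum_congr rfl fun i _ => Finset.sum_congr rfl fun k _ =>
      Finset.sum_congr rfl fun l _ => ?_
    rw [hG.apply i k]
  have third_term : ∑ l, Matrix.trace (P * D l) * P l j =
      ∑ i, ∑ k, ∑ l, P i k * P j l * D l i k := by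
    simp only [Matrix.trace, diag_apply, mul_apply, Finset.sum_mul]
    rw [Finset.sum_comm]
    refine Finset.sum_congr rfl fun i _ => ?_
    rw [Finset.sum_comm]
    refine Finset.sum_congr rfl fun k _ => Finset.sum_congr rfl fun l _ => ?_
    rw [hG.apply j l, show D l k i = D l i k from (hD l).apply i k]
    ring
  have christoffel_expansion : ∑ i, ∑ k, P i k * christoffel G j i k y =
      (1 / 2) * (∑ i, ∑ k, ∑ l, P i k * P j l * D i k l + ∑ i, ∑ k, ∑ l, P i k * P j l * D k i l
        - ∑ i, ∑ k, ∑ l, P i k * P j l * D l i k) := by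
    simp only [← Finset.sum_add_distrib, ← Finset.sum_sub_distrib, Finset.mul_sum, christoffel]
    refine Finset.sum_congr rfl fun i _ => Finset.sum_congr rfl fun k _ =>
      Finset.sum_congr rfl fun l _ => ?_
    simp only [P, D, metricDeriv, of_apply]
    ring
  rw [christoffel_expansion, second_term, ← third_term, ← first_term, Finset.sum_sub_distrib]
  simp only [mul_assoc]
  rw [← Finset.mul_sum]
  ring

section DivergenceForm

variable (hU : IsOpen U) (hG : ∀ i j, ContDiffOn ℝ ∞ (fun z => G z i j) U)
  (hpos : ∀ z ∈ U, (G z).PosDef)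
include hU hG hpos

omit hpos in
theorem hasDerivWithinAt_metric_line (hy : y ∈ U) (k i j : Fin n) :
    HasDerivWithinAt (fun σ : ℝ => G (y + σ • EuclideanSpace.single k 1) i j)
      (metricDeriv G k y i j) univ 0 :=
  (hasDerivAt_line (differentiableAt_of_contDiffOn hU (hG i j) hy) _).hasDerivWithinAt

theorem pderiv_sqrt_det (hy : y ∈ U) (k : Fin n) :
    pderiv k (fun z => √(G z).det) y =
      √(G y).det * ((1 / 2) * Matrix.trace ((G y)⁻¹ * metricDeriv G k y)) := by
  have hdet := (hpos y hy).det_pos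
  have along_line := hasDerivAt_line (differentiableAt_of_contDiffOn hU
    ((contDiffOn_det hG).sqrt fun z hz => (hpos z hz).det_pos.ne') hy) (EuclideanSpace.single k 1)
  have jacobi := hasDerivWithinAt_univ.1
    (hasDerivWithinAt_det (hasDerivWithinAt_metric_line hU hG hy k))
  rw [pderiv, along_line.unique (jacobi.sqrt (by simpa using hdet.ne'))]
  simp only [zero_smul, add_zero, adjugate_eq_det_smul_inv hdet.ne', Matrix.smul_mul, trace_smul,
    smul_eq_mul]
  rw [div_eq_iff (by positivity)]
  linear_combination -(Matrix.trace ((G y)⁻¹ * metricDeriv G k y)) * Real.mul_self_sqrt hdet.le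

theorem pderiv_inv (hy : y ∈ U) (k i j : Fin n) :
    pderiv k (fun z => (G z)⁻¹ i j) y = -((G y)⁻¹ * metricDeriv G k y * (G y)⁻¹) i j := by
  have along_line := hasDerivAt_line (differentiableAt_of_contDiffOn hU
    (contDiffOn_matrix_inv hG (fun z hz => (hpos z hz).det_pos.ne') i j) hy)
    (EuclideanSpace.single k 1)
  have inverse_rule := hasDerivWithinAt_univ.1 (hasDerivWithinAt_matrix_inv
    (hasDerivWithinAt_metric_line hU hG hy k) (by simpa using (hpos y hy).det_pos.ne') i j)
  rw [pderiv, along_line.unique inverse_rule]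
  simp only [zero_smul, add_zero, Matrix.neg_apply]

variable (hf : ContDiffOn ℝ ∞ f U)
include hf

theorem contDiffOn_gradDensity (i : Fin n) : ContDiffOn ℝ ∞ (gradDensity G f i) U :=
  have hdet : ∀ z ∈ U, (G z).det ≠ 0 := fun z hz => (hpos z hz).det_pos.ne'
  ((contDiffOn_det hG).sqrt hdet).mul <| ContDiffOn.sum fun j _ =>
    (contDiffOn_matrix_inv hG hdet i j).mul (contDiffOn_pderiv hU hf j)

theorem pderiv_gradDensity (hy : y ∈ U) (i : Fin n) :
    pderiv i (gradDensity G f i) y = √(G y).det *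
      (∑ j, ((1 / 2) * Matrix.trace ((G y)⁻¹ * metricDeriv G i y) * (G y)⁻¹ i j
          - ((G y)⁻¹ * metricDeriv G i y * (G y)⁻¹) i j) * pderiv j f y
        + ∑ j, (G y)⁻¹ i j * pderiv i (pderiv j f) y) := by
  have hdet : ∀ z ∈ U, (G z).det ≠ 0 := fun z hz => (hpos z hz).det_pos.ne'
  have diff_inv (j : Fin n) :=
    differentiableAt_of_contDiffOn hU (contDiffOn_matrix_inv hG hdet i j) hy
  have diff_pderiv (j : Fin n) :=
    differentiableAt_of_contDiffOn hU (contDiffOn_pderiv hU hf j) hy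
  have product_rule := pderiv_mul
    (differentiableAt_of_contDiffOn hU ((contDiffOn_det hG).sqrt hdet) hy)
    (DifferentiableAt.fun_sum (u := Finset.univ) fun j _ =>
      (diff_inv j).fun_mul (diff_pderiv j)) i
  refine product_rule.trans ?_
  rw [pderiv_sum fun j _ => (diff_inv j).fun_mul (diff_pderiv j), pderiv_sqrt_det hU hG hpos hy,
    mul_assoc, ← mul_add, Finset.mul_sum, ← Finset.sum_add_distrib, ← Finset.sum_add_distrib]
  congr 1
  refine Finset.sum_congr rfl fun j _ => ?_
  rw [pderiv_mul (diff_inv j) (diff_pderiv j), pderiv_inv hU hG hpos hy]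
  ring

theorem sum_pderiv_gradDensity (hy : y ∈ U) :
    ∑ i, pderiv i (gradDensity G f i) y = √(G y).det * laplacian G f y := by
  have inv_symm : (G y)⁻¹.IsSymm := by
    exact (conjTranspose_eq_transpose_of_trivial _).symm.trans (hpos y hy).inv.isHermitian
  have deriv_symm (k : Fin n) : (metricDeriv G k y).IsSymm := by
    ext i j
    refine pderiv_congr ?_ k
    filter_upwards [hU.mem_nhds hy] with z hz
    simpa using (hpos z hz).isHermitian.apply i j
  have first_order : ∑ i, ∑ j, ((1 / 2) * Matrix.trace ((G y)⁻¹ * metricDeriv G i y) * (G y)⁻¹ i j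
        - ((G y)⁻¹ * metricDeriv G i y * (G y)⁻¹) i j) * pderiv j f y =
      -∑ i, ∑ j, (G y)⁻¹ i j * ∑ k, christoffel G k i j y * pderiv k f y := by
    rw [Finset.sum_comm]
    simp only [← Finset.sum_mul, contracted_christoffel inv_symm deriv_symm, neg_mul,
      Finset.sum_neg_distrib]
    simp only [Finset.sum_mul, Finset.mul_sum, mul_assoc]
    rw [Finset.sum_comm]
    exact congrArg _ (Finset.sum_congr rfl fun i _ => Finset.sum_comm)
  simp only [pderiv_gradDensity hU hG hpos hf hy]
  rw [← Finset.mul_sum, Finset.sum_add_distrib, first_order]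
  simp only [laplacian, hessian, mul_sub, Finset.sum_sub_distrib]
  ring

end DivergenceForm

theorem deriv_deriv_nonpos_of_isLocalMax {φ : ℝ → ℝ} {a : ℝ} (hmax : IsLocalMax φ a)
    (hφ : ContinuousAt φ a) : deriv (deriv φ) a ≤ 0 := by
  by_contra hlt
  have hmin := isLocalMin_of_deriv_deriv_pos (not_le.1 hlt) hmax.deriv_eq_zero hφ
  have hconst : φ =ᶠ[𝓝 a] fun _ => φ a := by
    filter_upwards [hmax, hmin] with z hz hz' using le_antisymm hz hz'
  have hderiv : deriv φ =ᶠ[𝓝 a] fun _ => 0 := by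
    simpa using hconst.deriv
  exact hlt (by simpa using hderiv.deriv_eq.le)

theorem sum_pderiv_pderiv_nonpos_of_isLocalMax (hU : IsOpen U) (hf : ContDiffOn ℝ ∞ f U)
    (hy : y ∈ U) (hmax : IsLocalMax f y) (v : Coord n) :
    ∑ i, ∑ j, v i * pderiv i (pderiv j f) y * v j ≤ 0 := by
  have line_tendsto : Tendsto (fun σ : ℝ => y + σ • v) (𝓝 0) (𝓝 y) := by
    have : Continuous fun σ : ℝ => y + σ • v := by fun_prop
    simpa using this.tendsto 0
  have line_max : IsLocalMax (fun σ : ℝ => f (y + σ • v)) 0 := by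
    filter_upwards [line_tendsto.eventually hmax] with σ hσ
    simpa using hσ
  have first_deriv : deriv (fun σ : ℝ => f (y + σ • v)) =ᶠ[𝓝 0]
      fun σ => ∑ j, v j * pderiv j f (y + σ • v) := by
    filter_upwards [line_tendsto.eventually (hU.mem_nhds hy)] with σ hσ
    have hline : HasDerivAt (fun σ : ℝ => y + σ • v) v σ := by
      simpa using ((hasDerivAt_id σ).smul_const v).const_add y
    exact ((differentiableAt_of_contDiffOn hU hf hσ).hasFDerivAt.comp_hasDerivAt σ
      hline).deriv.trans (fderiv_eq_sum_pderiv _ _ _)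
  have second_deriv : HasDerivAt (fun σ : ℝ => ∑ j, v j * pderiv j f (y + σ • v))
      (∑ j, v j * fderiv ℝ (pderiv j f) y v) 0 :=
    HasDerivAt.fun_sum fun j _ => (hasDerivAt_line
      (differentiableAt_of_contDiffOn hU (contDiffOn_pderiv hU hf j) hy) v).const_mul _
  have := deriv_deriv_nonpos_of_isLocalMax line_max
    (hasDerivAt_line (differentiableAt_of_contDiffOn hU hf hy) v).continuousAt
  rw [first_deriv.deriv_eq, second_deriv.deriv] at this
  simp only [fderiv_eq_sum_pderiv _ y v, Finset.mul_sum] at this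
  rw [Finset.sum_comm] at this
  simpa only [mul_comm, mul_left_comm] using this

theorem laplacian_nonpos_of_isLocalMax (hU : IsOpen U) (hpos : (G y).PosDef)
    (hf : ContDiffOn ℝ ∞ f U) (hy : y ∈ U) (hmax : IsLocalMax f y) : laplacian G f y ≤ 0 := by
  have critical (k : Fin n) : pderiv k f y = 0 := by
    simp [pderiv, hmax.fderiv_eq_zero]
  have hessian_nonneg (v : Fin n → ℝ) :
      0 ≤ v ⬝ᵥ (of fun i j => -pderiv j (pderiv i f) y) *ᵥ v := by
    have := sum_pderiv_pderiv_nonpos_of_isLocalMax hU hf hy hmax (WithLp.toLp 2 v)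
    rw [Finset.sum_comm] at this
    simp only [dotProduct, mulVec, of_apply, Finset.mul_sum, neg_mul, mul_neg,
      Finset.sum_neg_distrib, neg_nonneg]
    simpa only [mul_comm, mul_left_comm] using this
  have := trace_mul_nonneg hpos.inv.posSemidef hessian_nonneg
  simpa only [laplacian, hessian, critical, Matrix.trace, diag_apply, mul_apply, of_apply, mul_neg,
    Finset.sum_neg_distrib, neg_nonneg, mul_zero, Finset.sum_const_zero, sub_zero] using this

section IntegrationByParts

variable {K : Set (Coord n)} (hU : IsOpen U) (hK : IsCompact K) (hKU : K ⊆ U)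
include hU hK hKU

omit hU hKU in
theorem eventuallyEq_zero_of_eq_zero_diff_isCompact (hf0 : ∀ y ∈ U \ K, f y = 0)
    (hy : y ∉ K) : U.indicator f =ᶠ[𝓝 y] fun _ => 0 := by
  filter_upwards [hK.isClosed.isOpen_compl.mem_nhds hy] with z hz
  exact indicator_apply_eq_zero.2 fun hzU => hf0 z ⟨hzU, hz⟩

omit hK hKU in
theorem pderiv_indicator_of_mem (f : Coord n → ℝ) (hy : y ∈ U) (k : Fin n) :
    pderiv k (U.indicator f) y = pderiv k f y :=
  pderiv_congr (eqOn_indicator.eventuallyEq_of_mem (hU.mem_nhds hy)) k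

theorem differentiable_indicator (hf : ContDiffOn ℝ ∞ f U) (hf0 : ∀ y ∈ U \ K, f y = 0) :
    Differentiable ℝ (U.indicator f) := fun y => by
  by_cases hy : y ∈ U
  · exact (differentiableAt_of_contDiffOn hU hf hy).congr_of_eventuallyEq
      (eqOn_indicator.eventuallyEq_of_mem (hU.mem_nhds hy))
  · exact (differentiableAt_const 0).congr_of_eventuallyEq
      (eventuallyEq_zero_of_eq_zero_diff_isCompact hK hf0 fun hyK => hy (hKU hyK))

theorem pderiv_indicator (hf0 : ∀ y ∈ U \ K, f y = 0) (k : Fin n) :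
    pderiv k (U.indicator f) = U.indicator (pderiv k f) := by
  ext y
  by_cases hy : y ∈ U
  · rw [pderiv_indicator_of_mem hU f hy, indicator_of_mem hy]
  · rw [pderiv_congr (eventuallyEq_zero_of_eq_zero_diff_isCompact hK hf0 fun hyK => hy (hKU hyK)),
      indicator_of_notMem hy]
    simp [pderiv]

theorem integrable_pderiv_indicator (hf : ContDiffOn ℝ ∞ f U) (hf0 : ∀ y ∈ U \ K, f y = 0)
    (k : Fin n) : Integrable (pderiv k (U.indicator f)) := by
  have pderiv_zero : ∀ y ∉ K, pderiv k (U.indicator f) y = 0 := fun y hy => by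
    rw [pderiv_congr (eventuallyEq_zero_of_eq_zero_diff_isCompact hK hf0 hy)]
    simp [pderiv]
  refine (integrableOn_iff_integrable_of_support_subset (s := K) fun y hy => ?_).1
    (ContinuousOn.integrableOn_compact hK ?_)
  · exact not_imp_comm.1 (pderiv_zero y) hy
  · exact ((contDiffOn_pderiv hU hf k).continuousOn.mono hKU).congr fun y hy =>
      pderiv_indicator_of_mem hU f (hKU hy) k

theorem integrableOn_pderiv (hf : ContDiffOn ℝ ∞ f U) (hf0 : ∀ y ∈ U \ K, f y = 0)
    (k : Fin n) : IntegrableOn (pderiv k f) U := by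
  rw [← integrable_indicator_iff hU.measurableSet, ← pderiv_indicator hU hK hKU hf0]
  exact integrable_pderiv_indicator hU hK hKU hf hf0 k

theorem setIntegral_pderiv_eq_zero (hf : ContDiffOn ℝ ∞ f U) (hf0 : ∀ y ∈ U \ K, f y = 0)
    (k : Fin n) : ∫ y in U, pderiv k f y = 0 := by
  have hdiff := differentiable_indicator hU hK hKU hf hf0
  have hint : Integrable (U.indicator f) :=
    hdiff.continuous.integrable_of_hasCompactSupport <| HasCompactSupport.intro hK fun y hy =>
      (eventuallyEq_zero_of_eq_zero_diff_isCompact hK hf0 hy).self_of_nhds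
  have by_parts := integral_mul_fderiv_eq_neg_fderiv_mul_of_integrable (μ := volume)
    (f := fun _ => 1) (g := U.indicator f) (v := EuclideanSpace.single k 1) (by simp)
    (by simpa only [one_mul, pderiv] using! integrable_pderiv_indicator hU hK hKU hf hf0 k)
    (by simpa only [one_mul] using hint) (by simp) fun y _ => hdiff y
  rw [← integral_indicator hU.measurableSet, ← pderiv_indicator hU hK hKU hf0]
  simpa [pderiv] using by_parts

theorem setIntegral_mul_laplacian_add_gradInner (hG : ∀ i j, ContDiffOn ℝ ∞ (fun z => G z i j) U)
    (hpos : ∀ z ∈ U, (G z).PosDef) (hf : ContDiffOn ℝ ∞ f U) (hψ : ContDiffOn ℝ ∞ ψ U)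
    (hψ0 : ∀ y ∈ U \ K, ψ y = 0) :
    ∫ y in U, √(G y).det * (ψ y * laplacian G f y + gradInner G ψ f y) = 0 := by
  have hW := contDiffOn_gradDensity hU hG hpos hf
  have flux_zero (i : Fin n) : ∀ y ∈ U \ K, ψ y * gradDensity G f i y = 0 := fun y hy => by
    rw [hψ0 y hy, zero_mul]
  have divergence : ∀ y ∈ U, √(G y).det * (ψ y * laplacian G f y + gradInner G ψ f y) =
      ∑ i, pderiv i (fun z => ψ z * gradDensity G f i z) y := fun y hy => by
    have product_rule (i : Fin n) : pderiv i (fun z => ψ z * gradDensity G f i z) y =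
        ψ y * pderiv i (gradDensity G f i) y + pderiv i ψ y * gradDensity G f i y :=
      pderiv_mul (differentiableAt_of_contDiffOn hU hψ hy)
        (differentiableAt_of_contDiffOn hU (hW i) hy) i
    simp only [product_rule, Finset.sum_add_distrib]
    rw [← Finset.mul_sum, sum_pderiv_gradDensity hU hG hpos hf hy, sum_pderiv_mul_gradDensity]
    ring
  rw [setIntegral_congr_fun hU.measurableSet divergence,
    integral_finsetSum _ fun i _ => integrableOn_pderiv hU hK hKU (hψ.mul (hW i)) (flux_zero i) i]
  exact Finset.sum_eq_zero fun i _ =>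
    setIntegral_pderiv_eq_zero hU hK hKU (hψ.mul (hW i)) (flux_zero i) i

end IntegrationByParts

end CoordTensor

/-! ### The divergence theorem -/

section DivergenceTheorem

open CoordTensor Matrix

variable {n : ℕ} {X : Type*} [TopologicalSpace X] [ChartedSpace (Coord n) X]

/-- The components of the differential of a function at `x` in the coordinates of the preferred
chart at `x`. -/
def differential (n : ℕ) {X : Type*} [TopologicalSpace X] [ChartedSpace (Coord n) X]
    (f : X → ℝ) (x : X) (i : Fin n) : ℝ :=
  (mfderiv (𝓡 n) 𝓘(ℝ, ℝ) f x : Coord n →L[ℝ] ℝ) (EuclideanSpace.single i 1)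

/-- The inner product of the gradients of two functions with respect to the metric `h`. -/
def TwoTensor.gradInner (h : TwoTensor n X) (f g : X → ℝ) (x : X) : ℝ :=
  differential n f x ⬝ᵥ (h.mat x)⁻¹ *ᵥ differential n g x

/-- `D` is the Laplacian of `f` with respect to the metric `h`. -/
def TwoTensor.IsLaplacian (h : TwoTensor n X) (f D : X → ℝ) : Prop :=
  ∀ c ∈ atlas (Coord n) X, ∀ y ∈ c.target,
    D (c.symm y) = laplacian (h.comp c) (fun z => f (c.symm z)) y

variable [IsManifold (𝓡 n) ∞ X] {h : TwoTensor n X} {c : OpenPartialHomeomorph X (Coord n)}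
  {f g ρ D : X → ℝ} {y : Coord n}

theorem contMDiff_of_charts
    (hf : ∀ c ∈ atlas (Coord n) X, ContDiffOn ℝ ∞ (fun y => f (c.symm y)) c.target) :
    ContMDiff (𝓡 n) 𝓘(ℝ, ℝ) ∞ f := fun x => by
  set c := chartAt (Coord n) x
  have on_source : ContMDiffOn (𝓡 n) 𝓘(ℝ, ℝ) ∞ f c.source :=
    ((hf c (chart_mem_atlas _ _)).contMDiffOn.comp contMDiffOn_chart fun z hz =>
      c.map_source hz).congr fun z hz => by simp [c, c.left_inv hz]
  exact on_source.contMDiffAt (chart_source_mem_nhds _ x)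

theorem contDiffOn_comp_chart_symm (hf : ContMDiff (𝓡 n) 𝓘(ℝ, ℝ) ∞ f)
    (hc : c ∈ atlas (Coord n) X) : ContDiffOn ℝ ∞ (fun y => f (c.symm y)) c.target :=
  (hf.comp_contMDiffOn <|
    contMDiffOn_symm_of_mem_maximalAtlas (IsManifold.subset_maximalAtlas hc)).contDiffOn

theorem pderiv_chart (hf : ContMDiff (𝓡 n) 𝓘(ℝ, ℝ) ∞ f) (hc : c ∈ atlas (Coord n) X)
    (hy : y ∈ c.target) :
    (pderiv · (fun z => f (c.symm z)) y) = (coordMatrix c y)ᵀ *ᵥ differential n f (c.symm y) := by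
  ext i
  have chain := mfderiv_comp (I := 𝓡 n) (I' := 𝓡 n) (I'' := 𝓘(ℝ, ℝ)) y
    (hf.mdifferentiable (by norm_num) (c.symm y))
    ((mdifferentiable_of_mem_smooth_atlas hc).mdifferentiableAt_symm hy)
  rw [mfderiv_eq_fderiv] at chain
  let B : Coord n →L[ℝ] ℝ := mfderiv (𝓡 n) 𝓘(ℝ, ℝ) f (c.symm y)
  have hB : fderiv ℝ (fun z => f (c.symm z)) y = B.comp (chartDeriv c y) := chain
  rw [pderiv, hB, ContinuousLinearMap.comp_apply,
    ← (EuclideanSpace.basisFun (Fin n) ℝ).sum_repr (chartDeriv c y (EuclideanSpace.single i 1))]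
  simp only [map_sum, map_smul, smul_eq_mul, EuclideanSpace.basisFun_repr,
    EuclideanSpace.basisFun_apply, mulVec, dotProduct, transpose_apply, coordMatrix_apply]
  rfl

theorem gradInner_chart (h : TwoTensor n X) (hf : ContMDiff (𝓡 n) 𝓘(ℝ, ℝ) ∞ f)
    (hg : ContMDiff (𝓡 n) 𝓘(ℝ, ℝ) ∞ g) (hc : c ∈ atlas (Coord n) X) (hy : y ∈ c.target) :
    h.gradInner f g (c.symm y) = CoordTensor.gradInner (h.comp c) (fun z => f (c.symm z))
      (fun z => g (c.symm z)) y := by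
  rw [CoordTensor.gradInner, pderiv_chart hf hc hy, pderiv_chart hg hc hy, h.comp_eq,
    dotProduct_inv_mulVec_congruence (coordMatrix_det_ne_zero hc hy), TwoTensor.gradInner]

theorem continuous_gradInner (hh : h.IsRiemannian) (hf : ContMDiff (𝓡 n) 𝓘(ℝ, ℝ) ∞ f)
    (hg : ContMDiff (𝓡 n) 𝓘(ℝ, ℝ) ∞ g) : Continuous (h.gradInner f g) := by
  refine continuous_of_charts (n := n) fun c hc =>
    ContinuousOn.congr ?_ fun y hy => gradInner_chart h hf hg hc hy
  have cont_pderiv {f : X → ℝ} (hf : ContMDiff (𝓡 n) 𝓘(ℝ, ℝ) ∞ f) (i : Fin n) :=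
    (contDiffOn_pderiv c.open_target (contDiffOn_comp_chart_symm hf hc) i).continuousOn
  have cont_inv (i j : Fin n) := (contDiffOn_matrix_inv (hh.smooth c hc)
    (fun z hz => (hh.det_pos hc hz).ne') i j).continuousOn
  unfold CoordTensor.gradInner dotProduct mulVec dotProduct
  exact continuousOn_finsetSum _ fun i _ => (cont_pderiv hf i).mul <|
    continuousOn_finsetSum _ fun j _ => (cont_inv i j).mul (cont_pderiv hg j)

theorem sum_gradInner_eq_zero {ι : Type*} [Fintype ι] {ρ : ι → X → ℝ} (h : TwoTensor n X)
    (hρ : ∀ a, ContMDiff (𝓡 n) 𝓘(ℝ, ℝ) ∞ (ρ a)) (hsum : ∀ x, ∑ a, ρ a x = 1)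
    (hf : ContMDiff (𝓡 n) 𝓘(ℝ, ℝ) ∞ f) (x : X) : ∑ a, h.gradInner (ρ a) f x = 0 := by
  set c := chartAt (Coord n) x
  have hc : c ∈ atlas (Coord n) X := chart_mem_atlas _ _
  have hy : c x ∈ c.target := mem_chart_target _ x
  have pderiv_zero : ∑ a, (pderiv · (fun z => ρ a (c.symm z)) (c x)) = 0 := by
    ext i
    rw [Finset.sum_apply, ← pderiv_sum fun a _ =>
      differentiableAt_of_contDiffOn c.open_target (contDiffOn_comp_chart_symm (hρ a) hc) hy]
    simp [hsum, pderiv]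
  rw [← c.left_inv (mem_chart_source _ x)]
  simp only [gradInner_chart h (hρ _) hf hc hy, CoordTensor.gradInner, ← sum_dotProduct,
    pderiv_zero, zero_dotProduct]

omit [IsManifold (𝓡 n) ∞ X] in
theorem gradInner_eq_zero_of_notMem_tsupport (h : TwoTensor n X) (f : X → ℝ) {x : X}
    (hx : x ∉ tsupport ρ) : h.gradInner ρ f x = 0 := by
  have mfderiv_zero : (mfderiv (𝓡 n) 𝓘(ℝ, ℝ) ρ x : Coord n →L[ℝ] ℝ) = 0 := by
    rw [(notMem_tsupport_iff_eventuallyEq.1 hx).mfderiv_eq]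
    exact mfderiv_const
  have : differential n ρ x = 0 := by
    ext i
    rw [differential, mfderiv_zero]
    rfl
  rw [TwoTensor.gradInner, this, zero_dotProduct]

variable [MeasurableSpace X] [BorelSpace X] [CompactSpace X]

theorem integral_mul_laplacian_add_gradInner (hh : h.IsRiemannian)
    (hf : ContMDiff (𝓡 n) 𝓘(ℝ, ℝ) ∞ f) (hD : h.IsLaplacian f D) (hD_cont : Continuous D)
    (hρ : ContMDiff (𝓡 n) 𝓘(ℝ, ℝ) ∞ ρ) (hc : c ∈ atlas (Coord n) X)
    (hρc : tsupport ρ ⊆ c.source) :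
    ∫ x, (ρ x * D x + h.gradInner ρ f x) ∂h.volumeMeasure = 0 := by
  have hK : IsCompact (c '' tsupport ρ) := (isClosed_tsupport ρ).isCompact.image_of_continuousOn
    (c.continuousOn.mono hρc)
  have hKU : c '' tsupport ρ ⊆ c.target := by
    rintro _ ⟨x, hx, rfl⟩
    exact c.map_source (hρc hx)
  have hρ0 : ∀ y ∈ c.target \ c '' tsupport ρ, ρ (c.symm y) = 0 := fun y hy =>
    image_eq_zero_of_notMem_tsupport fun hmem => hy.2 ⟨c.symm y, hmem, c.right_inv hy.1⟩
  have zero_off_source : ∀ x ∉ c.source, ρ x * D x + h.gradInner ρ f x = 0 := fun x hx => by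
    have hx' : x ∉ tsupport ρ := fun hmem => hx (hρc hmem)
    rw [image_eq_zero_of_notMem_tsupport hx', gradInner_eq_zero_of_notMem_tsupport h f hx',
      zero_mul, add_zero]
  have hcont : Continuous fun x => ρ x * D x + h.gradInner ρ f x :=
    (hρ.continuous.mul hD_cont).add (continuous_gradInner hh hρ hf)
  rw [← setIntegral_eq_integral_of_forall_compl_eq_zero zero_off_source,
    setIntegral_source_eq hh hc hcont.aestronglyMeasurable]
  refine Eq.trans (setIntegral_congr_fun c.open_target.measurableSet fun y hy => ?_) <|
    setIntegral_mul_laplacian_add_gradInner c.open_target hK hKU (hh.smooth c hc)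
      (fun z hz => hh.comp_posDef hc hz) (contDiffOn_comp_chart_symm hf hc)
      (contDiffOn_comp_chart_symm hρ hc) hρ0
  rw [hD c hc y hy, gradInner_chart h hρ hf hc hy]

variable [T2Space X]

theorem integral_laplacian_eq_zero (hh : h.IsRiemannian) (hf : ContMDiff (𝓡 n) 𝓘(ℝ, ℝ) ∞ f)
    (hD : h.IsLaplacian f D) (hD_cont : Continuous D) : ∫ x, D x ∂h.volumeMeasure = 0 := by
  have := hh.isLocallyFiniteMeasure
  obtain ⟨s, hs⟩ := CompactSpace.elim_nhds_subcover
    (fun x : X => (chartAt (Coord n) x).source) fun x => chart_source_mem_nhds _ x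
  obtain ⟨ρ, hρ⟩ := SmoothPartitionOfUnity.exists_isSubordinate (𝓡 n) (isClosed_univ (X := X))
    (fun x : s => (chartAt (Coord n) (x : X)).source)
    (fun x => (chartAt (Coord n) (x : X)).open_source)
    fun x _ => by simpa using hs.ge (mem_univ x)
  have hρ_smooth (a : s) : ContMDiff (𝓡 n) 𝓘(ℝ, ℝ) ∞ (ρ a) := (ρ a).contMDiff
  have hρ_sum (x : X) : ∑ a, ρ a x = 1 := by
    rw [← finsum_eq_sum_of_fintype]
    exact ρ.sum_eq_one (mem_univ x)
  have hint (a : s) : Integrable (fun x => ρ a x * D x + h.gradInner (ρ a) f x) h.volumeMeasure :=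
    (((hρ_smooth a).continuous.mul hD_cont).add
      (continuous_gradInner hh (hρ_smooth a) hf)).integrable_of_hasCompactSupport
      (HasCompactSupport.of_compactSpace _)
  calc ∫ x, D x ∂h.volumeMeasure
      = ∫ x, ∑ a, (ρ a x * D x + h.gradInner (ρ a) f x) ∂h.volumeMeasure := by
        simp only [Finset.sum_add_distrib, ← Finset.sum_mul, hρ_sum, one_mul, add_zero,
          sum_gradInner_eq_zero h hρ_smooth hρ_sum hf]
    _ = ∑ a, ∫ x, (ρ a x * D x + h.gradInner (ρ a) f x) ∂h.volumeMeasure :=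
        integral_finsetSum _ fun a _ => hint a
    _ = 0 := Finset.sum_eq_zero fun a _ => integral_mul_laplacian_add_gradInner hh hf hD hD_cont
        (hρ_smooth a) (chart_mem_atlas _ _) (hρ a)

end DivergenceTheorem

/-! ### Rescaling -/

section Rescaling

open CoordTensor

variable {n : ℕ}

theorem matrix_inv_smul {m 𝕜 : Type*} [Fintype m] [DecidableEq m] [Field 𝕜] {a : 𝕜} (ha : a ≠ 0)
    (A : Matrix m m 𝕜) : (a • A)⁻¹ = a⁻¹ • A⁻¹ := by
  by_cases hA : IsUnit A.det
  · simpa [Units.smul_def] using Matrix.inv_smul' A (Units.mk0 a ha) hA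
  · have hA' : ¬IsUnit (a • A).det := by simpa [Matrix.det_smul, ha] using hA
    rw [Matrix.nonsing_inv_apply_not_isUnit _ hA, Matrix.nonsing_inv_apply_not_isUnit _ hA',
      smul_zero]

namespace CoordTensor

variable {a : ℝ}

theorem pderiv_const_mul (a : ℝ) (f : Coord n → ℝ) (k : Fin n) (y : Coord n) :
    pderiv k (fun z => a * f z) y = a * pderiv k f y := by
  rw [pderiv, show (fun z => a * f z) = a • f from rfl, fderiv_const_smul_field]
  rfl

variable (G T : CoordTensor n) (y : Coord n)

theorem christoffel_smul (ha : a ≠ 0) (k i j : Fin n) :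
    christoffel (fun z => a • G z) k i j = christoffel G k i j := by
  ext y
  simp only [christoffel, matrix_inv_smul ha, Matrix.smul_apply, smul_eq_mul, pderiv_const_mul]
  congr 1
  refine Finset.sum_congr rfl fun l _ => ?_
  field_simp

theorem scalar_smul (ha : a ≠ 0) : scalar (fun z => a • G z) y = a⁻¹ * scalar G y := by
  simp only [scalar, ricci, christoffel_smul G ha, matrix_inv_smul ha, Matrix.smul_apply,
    smul_eq_mul, Finset.mul_sum, mul_assoc]

theorem trace_smul (ha : a ≠ 0) (b : ℝ) :
    trace (fun z => a • G z) (fun z => b • T z) y = b / a * trace G T y := by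
  simp only [trace, matrix_inv_smul ha, Matrix.smul_apply, smul_eq_mul, Finset.mul_sum]
  refine Finset.sum_congr rfl fun i _ => Finset.sum_congr rfl fun j _ => ?_
  ring

theorem traceFree_smul (ha : a ≠ 0) (b : ℝ) :
    traceFree (fun z => a • G z) (fun z => b • T z) = fun z => b • traceFree G T z := by
  ext z i j
  simp only [traceFree, trace_smul G T z ha, Matrix.sub_apply, Matrix.smul_apply, smul_eq_mul]
  field_simp

theorem normSq_smul (ha : a ≠ 0) (b : ℝ) :
    normSq (fun z => a • G z) (fun z => b • T z) y = (b / a) ^ 2 * normSq G T y := by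
  simp only [normSq, matrix_inv_smul ha, Matrix.smul_apply, smul_eq_mul, Finset.mul_sum]
  refine Finset.sum_congr rfl fun i _ => Finset.sum_congr rfl fun j _ =>
    Finset.sum_congr rfl fun k _ => Finset.sum_congr rfl fun l _ => ?_
  ring

end CoordTensor

variable {X : Type*} [TopologicalSpace X] [ChartedSpace (Coord n) X]

theorem TwoTensor.comp_smul (T : TwoTensor n X) (c : OpenPartialHomeomorph X (Coord n)) (a : ℝ) :
    TwoTensor.comp (fun x => a • T x) c = fun y => a • T.comp c y :=
  rfl

theorem FlowData.rescale_K0sq (F : FlowData n X) {s : ℝ} (hs : s ≠ 0) (u : ℝ) (x : X) :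
    (F.rescale s).K0sq u x = s ^ 2 * F.K0sq (s * u) x := by
  have hs2 : (s ^ 2)⁻¹ ≠ 0 := inv_ne_zero (pow_ne_zero 2 hs)
  simp only [FlowData.K0sq, FlowData.rescale, TwoTensor.traceFreeNormSq, TwoTensor.comp_smul]
  rw [traceFree_smul _ _ hs2, normSq_smul _ _ _ hs2]
  congr 1
  field_simp

theorem FlowData.rescale_R (F : FlowData n X) {s : ℝ} (hs : s ≠ 0) (u : ℝ) (x : X) :
    (F.rescale s).R u x = s ^ 2 * F.R (s * u) x := by
  simp only [FlowData.R, FlowData.rescale, TwoTensor.scalarCurvature, TwoTensor.comp_smul]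
  rw [scalar_smul _ _ (inv_ne_zero (pow_ne_zero 2 hs)), inv_inv]

end Rescaling

/-! ### Consequences of the flow equations -/

section MetricTrace

open Matrix

variable {m : Type*} [Fintype m] [DecidableEq m]

theorem hasDerivWithinAt_metricTrace {g T : ℝ → Matrix m m ℝ} {g' T' : Matrix m m ℝ} {s : Set ℝ}
    {t : ℝ} (hg : ∀ i j, HasDerivWithinAt (fun τ => g τ i j) (g' i j) s t)
    (hT : ∀ i j, HasDerivWithinAt (fun τ => T τ i j) (T' i j) s t) (h0 : (g t).det ≠ 0) :
    HasDerivWithinAt (fun τ => metricTrace (g τ) (T τ))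
      (metricTrace (g t) T' - trace ((g t)⁻¹ * g' * (g t)⁻¹ * (T t)ᵀ)) s t := by
  have hsum := HasDerivWithinAt.fun_sum (u := Finset.univ) fun i _ =>
    HasDerivWithinAt.fun_sum (u := Finset.univ) fun j _ =>
      (hasDerivWithinAt_matrix_inv hg h0 i j).fun_mul (hT i j)
  simp only [metricTrace_eq_sum]
  refine hsum.congr_deriv ?_
  simp only [Finset.sum_add_distrib, Matrix.neg_apply, neg_mul, Finset.sum_neg_distrib, trace,
    diag_apply, mul_apply (M := _ * (g t)⁻¹), transpose_apply]
  ring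

end MetricTrace

namespace FlowData

open CoordTensor

variable {n : ℕ} {X : Type*} [TopologicalSpace X] [ChartedSpace (Coord n) X]
  {I : Set ℝ} {F : FlowData n X} {c : OpenPartialHomeomorph X (Coord n)} {y : Coord n}
  {x : X} {t t₁ : ℝ}

namespace IsEinsteinFlow

variable (hF : F.IsEinsteinFlow I)

include hF

theorem isRiemannian (ht : t ∈ I) : (F.h t).IsRiemannian where
  symm := hF.metric_symm t ht
  pos := hF.metric_pos t ht
  smooth c hc i j := (hF.smooth_h c hc i j).comp
    (contDiff_const.prodMk contDiff_id).contDiffOn fun _ hy => ⟨ht, hy⟩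

theorem contDiffOn_L (ht : t ∈ I) (hc : c ∈ atlas (Coord n) X) :
    ContDiffOn ℝ ∞ (fun y => F.L t (c.symm y)) c.target :=
  (hF.smooth_L c hc).comp (contDiff_const.prodMk contDiff_id).contDiffOn fun _ hy => ⟨ht, hy⟩

theorem comp_K_transpose (ht : t ∈ I) : ((F.K t).comp c y).transpose = (F.K t).comp c y := by
  ext i j
  exact hF.K_symm t ht _ _ _

theorem continuousOn_L : ContinuousOn (fun p : ℝ × X => F.L p.1 p.2) (I ×ˢ univ) :=
  continuousOn_of_charts (n := n) fun c hc => (hF.smooth_L c hc).continuousOn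

theorem continuous_L (ht : t ∈ I) : Continuous (F.L t) :=
  continuous_slice hF.continuousOn_L ht

variable [IsManifold (𝓡 n) ∞ X]

theorem K0sq_nonneg (ht : t ∈ I) (x : X) : 0 ≤ F.K0sq t x :=
  (hF.isRiemannian ht).traceFreeNormSq_nonneg

theorem contMDiff_L (ht : t ∈ I) : ContMDiff (𝓡 n) 𝓘(ℝ, ℝ) ∞ (F.L t) :=
  contMDiff_of_charts fun _ hc => hF.contDiffOn_L ht hc

theorem continuousOn_inv_h (hc : c ∈ atlas (Coord n) X) (i j : Fin n) :
    ContinuousOn (fun p : ℝ × Coord n => ((F.h p.1).comp c p.2)⁻¹ i j) (I ×ˢ c.target) :=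
  (contDiffOn_matrix_inv (A := fun p : ℝ × Coord n => (F.h p.1).comp c p.2) (hF.smooth_h c hc)
    (fun _ hp => ((hF.isRiemannian hp.1).det_pos hc hp.2).ne') i j).continuousOn

theorem continuousOn_K0sq : ContinuousOn (fun p : ℝ × X => F.K0sq p.1 p.2) (I ×ˢ univ) := by
  refine continuousOn_of_charts (n := n) fun c hc => ContinuousOn.congr
    (f := fun p : ℝ × Coord n => normSq ((F.h p.1).comp c)
      (traceFree ((F.h p.1).comp c) ((F.K p.1).comp c)) p.2) ?_
    fun _ hp => (normSq_traceFree_comp_eq_traceFreeNormSq hc hp.2).symm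
  have hK (i j : Fin n) := (hF.smooth_K c hc i j).continuousOn
  have hP := hF.continuousOn_inv_h hc
  have trace_cont : ContinuousOn (fun p : ℝ × Coord n =>
      CoordTensor.trace ((F.h p.1).comp c) ((F.K p.1).comp c) p.2) (I ×ˢ c.target) :=
    continuousOn_finsetSum _ fun i _ => continuousOn_finsetSum _ fun j _ => (hP i j).mul (hK i j)
  have traceFree_cont (i j : Fin n) : ContinuousOn (fun p : ℝ × Coord n =>
      traceFree ((F.h p.1).comp c) ((F.K p.1).comp c) p.2 i j) (I ×ˢ c.target) :=
    (hK i j).sub ((trace_cont.div_const _).mul (hF.smooth_h c hc i j).continuousOn)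
  exact continuousOn_finsetSum _ fun i _ => continuousOn_finsetSum _ fun j _ =>
    continuousOn_finsetSum _ fun k _ => continuousOn_finsetSum _ fun l _ =>
    (((hP i k).mul (hP j l)).mul (traceFree_cont i j)).mul (traceFree_cont k l)

theorem continuous_K0sq (ht : t ∈ I) : Continuous (F.K0sq t) :=
  continuous_slice hF.continuousOn_K0sq ht

theorem continuousOn_volumeRatio (ht₁ : t₁ ∈ I) :
    ContinuousOn (fun p : ℝ × X => (F.h t₁).volumeRatio (F.h p.1) p.2) (I ×ˢ univ) := by
  refine continuousOn_of_charts (n := n)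
    (φ := fun τ => (F.h t₁).volumeRatio (F.h τ)) fun c hc => ContinuousOn.congr ?_
    fun _ hp => volumeRatio_chart _ _ hc hp.2
  have numerator := (contDiffOn_det (A := fun p : ℝ × Coord n => (F.h p.1).comp c p.2)
    (hF.smooth_h c hc)).continuousOn
  have denominator : ContinuousOn (fun p : ℝ × Coord n => ((F.h t₁).comp c p.2).det)
      (I ×ˢ c.target) :=
    (contDiffOn_det ((hF.isRiemannian ht₁).smooth c hc)).continuousOn.comp
      continuousOn_snd fun _ hp => hp.2
  exact (numerator.div denominator fun _ hp => ((hF.isRiemannian ht₁).det_pos hc hp.2).ne').sqrt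

section Evolution

variable (ht : t ∈ I) (hc : c ∈ atlas (Coord n) X) (hy : y ∈ c.target)

include ht hc hy

theorem hasDerivWithinAt_trace :
    HasDerivWithinAt (fun τ => CoordTensor.trace ((F.h τ).comp c) ((F.K τ).comp c) y)
      (F.L t (c.symm y) * (scalar ((F.h t).comp c) y +
          CoordTensor.trace ((F.h t).comp c) ((F.K t).comp c) y ^ 2)
        - laplacian ((F.h t).comp c) (fun z => F.L t (c.symm z)) y) I t := by
  set g := (F.h t).comp c y with hg
  set B := (F.K t).comp c y with hB
  set ℓ := F.L t (c.symm y)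
  set Hess := Matrix.of fun i j => hessian ((F.h t).comp c) (fun z => F.L t (c.symm z)) i j y
  set Ric := Matrix.of fun i j => ricci ((F.h t).comp c) i j y
  have pos := (hF.isRiemannian ht).det_pos hc hy
  have hg_symm : g⁻¹.transpose = g⁻¹ := by
    simpa using ((hF.isRiemannian ht).comp_posDef hc hy).inv.isHermitian.eq
  have hB_symm : B.transpose = B := hF.comp_K_transpose ht
  have hg_deriv (i j : Fin n) : HasDerivWithinAt (fun τ => (F.h τ).comp c y i j)
      (((-2 * ℓ) • B) i j) I t := hF.evolution_h t ht c hc y hy i j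
  have hB_deriv (i j : Fin n) : HasDerivWithinAt (fun τ => (F.K τ).comp c y i j)
      (((ℓ * metricTrace g B) • B - (2 * ℓ) • (B * g⁻¹ * B) - Hess + ℓ • Ric) i j) I t := by
    refine (hF.evolution_K t ht c hc y hy i j).congr_deriv ?_
    simp only [trace_eq_metricTrace, Matrix.add_apply, Matrix.sub_apply, Matrix.smul_apply,
      smul_eq_mul, Matrix.mul_apply, Finset.sum_mul, ← hg, ← hB, Hess, Ric, Matrix.of_apply]
    rw [Finset.sum_comm]
    simp only [mul_comm (B i _)]
    rfl
  have hquad : Matrix.trace (g⁻¹ * (B * g⁻¹ * B).transpose) =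
      Matrix.trace (g⁻¹ * B * g⁻¹ * B) := by
    simp only [Matrix.transpose_mul, hg_symm, hB_symm, Matrix.mul_assoc]
  have hHess : laplacian ((F.h t).comp c) (fun z => F.L t (c.symm z)) y = metricTrace g Hess :=
    (metricTrace_eq_sum _ _).symm
  have hRic : scalar ((F.h t).comp c) y = metricTrace g Ric := (metricTrace_eq_sum _ _).symm
  simp only [trace_eq_metricTrace, hHess, hRic]
  refine (hasDerivWithinAt_metricTrace hg_deriv hB_deriv pos.ne').congr_deriv ?_
  simp only [metricTrace, ← hg, ← hB, hB_symm, Matrix.transpose_add, Matrix.transpose_sub,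
    Matrix.transpose_smul, mul_add, mul_sub, Matrix.mul_smul, Matrix.smul_mul, Matrix.trace_add,
    Matrix.trace_sub, Matrix.trace_smul, smul_eq_mul, hquad]
  ring

theorem hasDerivWithinAt_det :
    HasDerivWithinAt (fun τ => ((F.h τ).comp c y).det)
      (-2 * F.L t (c.symm y) * CoordTensor.trace ((F.h t).comp c) ((F.K t).comp c) y
        * ((F.h t).comp c y).det) I t := by
  have hdet := (hF.isRiemannian ht).det_pos hc hy
  have := _root_.hasDerivWithinAt_det (A := fun τ => (F.h τ).comp c y)
    (A' := (-2 * F.L t (c.symm y)) • (F.K t).comp c y) (hF.evolution_h t ht c hc y hy)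
  refine this.congr_deriv ?_
  rw [adjugate_eq_det_smul_inv hdet.ne', trace_eq_metricTrace, metricTrace, hF.comp_K_transpose ht]
  simp only [Matrix.mul_smul, Matrix.smul_mul, Matrix.trace_smul, smul_eq_mul]
  ring

omit hc hy in
theorem hasDerivWithinAt_volumeRatio (ht₁ : t₁ ∈ I) (x : X) :
    HasDerivWithinAt (fun τ => (F.h t₁).volumeRatio (F.h τ) x)
      (-F.L t x * F.H t x * (F.h t₁).volumeRatio (F.h t) x) I t := by
  set c := chartAt (Coord n) x
  have hc : c ∈ atlas (Coord n) X := chart_mem_atlas _ _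
  have hy : c x ∈ c.target := mem_chart_target _ x
  rw [← c.left_inv (mem_chart_source _ x), FlowData.H, ← trace_comp_eq_trace hc hy]
  simp only [volumeRatio_chart _ _ hc hy]
  have pos := (hF.isRiemannian ht).det_pos hc hy
  have ratio_pos := div_pos pos ((hF.isRiemannian ht₁).det_pos hc hy)
  refine (((hF.hasDerivWithinAt_det ht hc hy).div_const _).sqrt ratio_pos.ne').congr_deriv ?_
  have sq := Real.mul_self_sqrt ratio_pos.le
  rw [div_eq_iff (by positivity)]
  linear_combination (2 * F.L t (c.symm (c x)) *
    CoordTensor.trace ((F.h t).comp c) ((F.K t).comp c) (c x)) * sq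

end Evolution

end IsEinsteinFlow

end FlowData

/-! ### Hubble time -/

namespace FlowData

open CoordTensor

variable {n : ℕ} {X : Type*} [TopologicalSpace X] [ChartedSpace (Coord n) X]
  {I : Set ℝ} {F : FlowData n X} {x : X} {t t₁ : ℝ}

/-- The density of `t⁻ⁿ dvol(X, h(t))` with respect to `dvol(X, h(t₁))`. -/
def density (F : FlowData n X) (t₁ t : ℝ) (x : X) : ℝ :=
  (t ^ n)⁻¹ * (F.h t₁).volumeRatio (F.h t) x

namespace IsExpandingCMC

variable (hF : F.IsExpandingCMC I)

include hF

theorem uniqueDiffOn : UniqueDiffOn ℝ I := by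
  obtain ⟨t₀, rfl | rfl⟩ := hF.future
  · exact uniqueDiffOn_Ici t₀
  · exact uniqueDiffOn_Ioi t₀

theorem eventually_mem : ∀ᶠ t in atTop, t ∈ I := by
  obtain ⟨t₀, rfl | rfl⟩ := hF.future
  · exact eventually_ge_atTop t₀
  · exact eventually_gt_atTop t₀

theorem isUpperSet : IsUpperSet I := by
  obtain ⟨t₀, rfl | rfl⟩ := hF.future
  · exact isUpperSet_Ici t₀
  · exact isUpperSet_Ioi t₀

theorem H_neg (ht : t ∈ I) (x : X) : F.H t x < 0 := by
  obtain ⟨η, hη, -, hη_neg, -⟩ := hF.cmc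
  exact (hη t ht x).trans_lt (hη_neg t ht)

variable [Nonempty X] (hH : F.IsHubbleTime I)

include hH

theorem dim_pos : 0 < n := by
  obtain ⟨x⟩ := ‹Nonempty X›
  obtain ⟨t, ht, htpos⟩ := (hF.eventually_mem.and (eventually_gt_atTop 0)).exists
  refine Nat.pos_of_ne_zero fun hn => htpos.ne' ?_
  simpa [hn] using hH t ht x

theorem time_pos (ht : t ∈ I) : 0 < t := by
  obtain ⟨x⟩ := ‹Nonempty X›
  have hn : (0 : ℝ) < n := Nat.cast_pos.2 (hF.dim_pos hH)
  rw [hH t ht x]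
  exact div_pos_of_neg_of_neg (neg_neg_of_pos hn) (hF.H_neg ht x)

theorem H_eq (ht : t ∈ I) (x : X) : F.H t x = -n / t := by
  rw [eq_div_iff (hF.time_pos hH ht).ne', mul_comm, ← eq_div_iff (hF.H_neg ht x).ne]
  exact hH t ht x

theorem density_pos (ht₁ : t₁ ∈ I) (ht : t ∈ I) (x : X) : 0 < F.density t₁ t x :=
  mul_pos (inv_pos.2 (pow_pos (hF.time_pos hH ht) n))
    ((hF.isRiemannian ht₁).volumeRatio_pos (hF.isRiemannian ht) x)

variable [IsManifold (𝓡 n) ∞ X]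

theorem trace_eq {c : OpenPartialHomeomorph X (Coord n)} {y : Coord n} (ht : t ∈ I)
    (hc : c ∈ atlas (Coord n) X) (hy : y ∈ c.target) :
    CoordTensor.trace ((F.h t).comp c) ((F.K t).comp c) y = -n / t := by
  rw [trace_comp_eq_trace hc hy]
  exact hF.H_eq hH ht _

theorem scalar_eq {c : OpenPartialHomeomorph X (Coord n)} {y : Coord n} (ht : t ∈ I)
    (hc : c ∈ atlas (Coord n) X) (hy : y ∈ c.target) :
    scalar ((F.h t).comp c) y = F.K0sq t (c.symm y) - n * (n - 1) / t ^ 2 := by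
  have constraint := hF.hamiltonian t ht c hc y hy
  have htpos := hF.time_pos hH ht
  have hn : (0 : ℝ) < n := Nat.cast_pos.2 (hF.dim_pos hH)
  rw [normSq_traceFree_comp_eq_traceFreeNormSq hc hy, hF.trace_eq hH ht hc hy] at constraint
  rw [FlowData.K0sq, ← sub_eq_zero, ← constraint]
  field_simp
  ring

theorem R_eq (ht : t ∈ I) (x : X) : F.R t x = F.K0sq t x - n * (n - 1) / t ^ 2 := by
  rw [FlowData.R, TwoTensor.scalarCurvature,
    hF.scalar_eq hH ht (chart_mem_atlas _ _) (mem_chart_target _ x),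
    OpenPartialHomeomorph.left_inv _ (mem_chart_source _ x)]

theorem isLaplacian_lapse (ht : t ∈ I) : (F.h t).IsLaplacian (F.L t)
    fun x => F.K0sq t x * F.L t x - n / t ^ 2 * (1 - F.L t x) := fun c hc y hy => by
  have htpos := hF.time_pos hH ht
  have evolution := hF.hasDerivWithinAt_trace ht hc hy
  have hubble : HasDerivWithinAt (fun τ => -(n : ℝ) / τ) (n / t ^ 2) I t := by
    simpa [div_eq_mul_inv] using
      ((hasDerivAt_inv htpos.ne').const_mul (-(n : ℝ))).hasDerivWithinAt (s := I)
  have equal := (hF.uniqueDiffOn t ht).eq_deriv _ hubble <| evolution.congr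
    (fun τ hτ => (hF.trace_eq hH hτ hc hy).symm) (hF.trace_eq hH ht hc hy).symm
  rw [hF.trace_eq hH ht hc hy, hF.scalar_eq hH ht hc hy] at equal
  linear_combination -equal

theorem lapse_le_one [CompactSpace X] (ht : t ∈ I) (x : X) : F.L t x ≤ 1 := by
  obtain ⟨z, -, hz⟩ :=
    isCompact_univ.exists_isMaxOn univ_nonempty (hF.continuous_L ht).continuousOn
  refine (hz (mem_univ x)).trans ?_
  set c := chartAt (Coord n) z
  have hc : c ∈ atlas (Coord n) X := chart_mem_atlas _ _
  have hy : c z ∈ c.target := mem_chart_target _ z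
  have hzz : c.symm (c z) = z := c.left_inv (mem_chart_source _ z)
  have hΔ := laplacian_nonpos_of_isLocalMax c.open_target
    ((hF.isRiemannian ht).comp_posDef hc hy) (hF.contDiffOn_L ht hc) hy
    (Eventually.of_forall fun y => by
      simp only [hzz]
      exact hz (mem_univ _))
  rw [← hF.isLaplacian_lapse hH ht c hc _ hy, hzz] at hΔ
  have hK0 := mul_nonneg (hF.K0sq_nonneg ht z) (hF.lapse_nonneg t ht z)
  have hcoeff : 0 < (n : ℝ) / t ^ 2 :=
    div_pos (Nat.cast_pos.2 (hF.dim_pos hH)) (pow_pos (hF.time_pos hH ht) 2)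
  by_contra! hlt
  nlinarith [mul_pos hcoeff (sub_pos.2 hlt)]

theorem continuousOn_density (ht₁ : t₁ ∈ I) :
    ContinuousOn (fun p : ℝ × X => F.density t₁ p.1 p.2) (I ×ˢ univ) :=
  ((continuousOn_fst.pow n).inv₀ fun _ hp => (pow_pos (hF.time_pos hH hp.1) n).ne').mul
    (hF.continuousOn_volumeRatio ht₁)

theorem hasDerivWithinAt_density (ht₁ : t₁ ∈ I) (ht : t ∈ I) (x : X) :
    HasDerivWithinAt (fun τ => F.density t₁ τ x)
      (-(n / t * (1 - F.L t x) * F.density t₁ t x)) I t := by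
  have htpos := hF.time_pos hH ht
  have hpow : HasDerivWithinAt (fun τ : ℝ => (τ ^ n)⁻¹) (-(n / t * (t ^ n)⁻¹)) I t := by
    refine ((hasDerivAt_pow n t).fun_inv (pow_pos htpos n).ne').hasDerivWithinAt.congr_deriv ?_
    obtain ⟨m, rfl⟩ := Nat.exists_eq_succ_of_ne_zero (hF.dim_pos hH).ne'
    rw [Nat.succ_sub_one, pow_succ]
    field_simp
    rw [pow_succ]
  refine (hpow.fun_mul (hF.hasDerivWithinAt_volumeRatio ht ht₁ x)).congr_deriv ?_
  rw [hF.H_eq hH ht x, density]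
  ring

theorem antitoneOn_density [CompactSpace X] (ht₁ : t₁ ∈ I) (x : X) :
    AntitoneOn (fun t => F.density t₁ t x) I := by
  have hderiv {t : ℝ} (ht : t ∈ I) := hF.hasDerivWithinAt_density hH ht₁ ht x
  refine antitoneOn_of_hasDerivWithinAt_nonpos hF.interval.convex
    (fun t ht => (hderiv ht).continuousWithinAt)
    (fun t ht => (hderiv (interior_subset ht)).mono interior_subset) fun t ht => ?_
  have ht := interior_subset ht
  have htpos := hF.time_pos hH ht
  have hL := sub_nonneg.2 (hF.lapse_le_one hH ht x)
  have hpos := hF.density_pos hH ht₁ ht x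
  have := mul_nonneg (mul_nonneg (div_nonneg n.cast_nonneg htpos.le) hL) hpos.le
  linarith

variable [CompactSpace X] [MeasurableSpace X] [BorelSpace X]

theorem normalizedVolume_eq (ht₁ : t₁ ∈ I) (ht : t ∈ I) : F.normalizedVolume t =
    (F.h t₁).volumeMeasure.withDensity fun x => ENNReal.ofReal (F.density t₁ t x) := by
  have inv_pow_nonneg : 0 ≤ (t ^ n)⁻¹ := (inv_pos.2 (pow_pos (hF.time_pos hH ht) n)).le
  have hmeas := ((hF.isRiemannian ht₁).continuous_volumeRatio
    (hF.isRiemannian ht)).measurable.ennreal_ofReal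
  rw [FlowData.normalizedVolume, volumeMeasure_eq_withDensity (hF.isRiemannian ht₁)
    (hF.isRiemannian ht), ← withDensity_smul _ hmeas]
  exact congrArg _ (funext fun x => (ENNReal.ofReal_mul inv_pow_nonneg).symm)

theorem antitoneOn_normalizedVolume : AntitoneOn F.normalizedVolume I := fun s hs t ht hst => by
  rw [hF.normalizedVolume_eq hH hs hs, hF.normalizedVolume_eq hH hs ht]
  exact withDensity_mono (Eventually.of_forall fun x =>
    ENNReal.ofReal_le_ofReal (hF.antitoneOn_density hH hs x hs ht hst))

variable [T2Space X]

theorem integral_K0sq_mul_L (ht : t ∈ I) :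
    ∫ x, F.K0sq t x * F.L t x ∂(F.h t).volumeMeasure =
      n / t ^ 2 * ∫ x, (1 - F.L t x) ∂(F.h t).volumeMeasure := by
  have hR := hF.isRiemannian ht
  have := hR.isLocallyFiniteMeasure
  have hL := hF.continuous_L ht
  have hK := hF.continuous_K0sq ht
  have integrable {φ : X → ℝ} (hφ : Continuous φ) : Integrable φ (F.h t).volumeMeasure :=
    hφ.integrable_of_hasCompactSupport (HasCompactSupport.of_compactSpace _)
  have hΔ := integral_laplacian_eq_zero hR (hF.contMDiff_L ht) (hF.isLaplacian_lapse hH ht)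
    (by fun_prop)
  rw [integral_sub (integrable (by fun_prop)) (integrable (by fun_prop)), integral_const_mul] at hΔ
  linarith

end IsExpandingCMC

end FlowData

/-! ### Monotone families of measures and convergence in `L¹` -/

section MonotoneFamilies

variable {α : Type*} [MeasurableSpace α] {μ ν : Measure α} {f g : ℝ → α → ℝ}

theorem exists_measure_tendsto_of_antitone {ι : Type*} [Preorder ι] [IsDirectedOrder ι]
    [Nonempty ι] [(atTop : Filter ι).IsCountablyGenerated] {μ : ι → Measure α}
    [∀ i, IsFiniteMeasure (μ i)] (hμ : Antitone μ) :
    ∃ ν : Measure α, (∀ i, ν ≤ μ i) ∧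
      ∀ A, MeasurableSet A → Tendsto (fun i => μ i A) atTop (𝓝 (ν A)) := by
  have hlim (A : Set α) : Tendsto (fun i => μ i A) atTop (𝓝 (⨅ i, μ i A)) :=
    tendsto_atTop_iInf fun i j hij => hμ hij A
  obtain ⟨i₀⟩ := ‹Nonempty ι›
  have additive (A : ℕ → Set α) (hA : ∀ k, MeasurableSet (A k))
      (hdisj : Pairwise (Function.onFun Disjoint A)) :
      ⨅ i, μ i (⋃ k, A k) = ∑' k, ⨅ i, μ i (A k) := by
    have dominated : Tendsto (fun i => ∫⁻ k, μ i (A k) ∂Measure.count) atTop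
        (𝓝 (∫⁻ k, ⨅ i, μ i (A k) ∂Measure.count)) := by
      refine tendsto_lintegral_filter_of_dominated_convergence (fun k => μ i₀ (A k))
        (.of_forall fun i => measurable_of_countable _)
        ((eventually_ge_atTop i₀).mono fun i hi => .of_forall fun k => hμ hi (A k)) ?_
        (.of_forall fun k => hlim (A k))
      rw [lintegral_count, ← measure_iUnion hdisj hA]
      exact measure_ne_top _ _
    simp only [lintegral_count, ← measure_iUnion hdisj hA] at dominated
    exact tendsto_nhds_unique (hlim _) dominated
  refine ⟨Measure.ofMeasurable (fun A _ => ⨅ i, μ i A) (by simp) additive,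
    fun i => Measure.le_iff.2 fun A hA => ?_, fun A hA => ?_⟩
  · rw [Measure.ofMeasurable_apply A hA]
    exact iInf_le _ i
  · rw [Measure.ofMeasurable_apply A hA]
    exact hlim A

theorem tendsto_ofReal_mul_sub_rescaled {φ : ℝ → ℝ≥0∞} {a : ℝ≥0∞}
    (hφ : Tendsto φ atTop (𝓝 a)) (ha : a ≠ ⊤) {Λ : ℝ} (hΛ₀ : 0 < Λ) (C : ℝ) :
    Tendsto (fun s => ENNReal.ofReal C * (φ (s * Λ⁻¹) - φ (s * Λ))) atTop (𝓝 0) := by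
  have hsub := ENNReal.Tendsto.sub (hφ.comp (tendsto_id.atTop_mul_const (inv_pos.2 hΛ₀)))
    (hφ.comp (tendsto_id.atTop_mul_const hΛ₀)) (.inl ha)
  rw [tsub_self] at hsub
  simpa [Function.comp_def] using ENNReal.Tendsto.const_mul hsub (.inr ENNReal.ofReal_ne_top)

theorem tendstoZeroL1_of_le {B : ℝ → ℝ≥0∞} (hf : ∀ᶠ s in atTop, AEStronglyMeasurable (f s) μ)
    (hle : ∀ᶠ s in atTop, eLpNorm (f s) 1 μ ≤ B s) (hB : Tendsto B atTop (𝓝 0)) :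
    TendstoZeroL1 μ f := by
  have hlim : Tendsto (fun s => eLpNorm (f s) 1 μ) atTop (𝓝 0) :=
    tendsto_of_tendsto_of_tendsto_of_le_of_le' tendsto_const_nhds hB (.of_forall fun _ => zero_le)
      hle
  refine ⟨?_, hlim⟩
  filter_upwards [hf, hlim.eventually (gt_mem_nhds zero_lt_one)] with s hmeas hlt
  exact ⟨hmeas, hlt.trans ENNReal.one_lt_top⟩

theorem TendstoZeroL1.congr (hf : TendstoZeroL1 μ f) (hfg : ∀ᶠ s in atTop, f s =ᵐ[μ] g s) :
    TendstoZeroL1 μ g :=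
  ⟨by filter_upwards [hf.1, hfg] with s hs hae using (memLp_congr_ae hae).1 hs,
    hf.2.congr' (hfg.mono fun _ hae => eLpNorm_congr_ae hae)⟩

theorem tendstoZeroL1_zero_measure (f : ℝ → α → ℝ) : TendstoZeroL1 (0 : Measure α) f := by
  simp [TendstoZeroL1]

theorem eLpNorm_rnDeriv_sub_one_le [IsFiniteMeasure μ] [IsFiniteMeasure ν] (h : μ ≤ ν) :
    eLpNorm (fun x => (ν.rnDeriv μ x).toReal - 1) 1 μ ≤ ν univ - μ univ := by
  have hadd : ν.rnDeriv μ =ᵐ[μ] (ν - μ).rnDeriv μ + 1 := by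
    have := Measure.rnDeriv_add' (ν - μ) μ μ
    rw [Measure.sub_add_cancel_of_le h] at this
    filter_upwards [this, Measure.rnDeriv_self μ] with x hx hself
    rw [hx, Pi.add_apply, hself, Pi.add_apply, Pi.one_apply]
  calc eLpNorm (fun x => (ν.rnDeriv μ x).toReal - 1) 1 μ
      = ∫⁻ x, (ν - μ).rnDeriv μ x ∂μ := by
        rw [eLpNorm_one_eq_lintegral_enorm]
        refine lintegral_congr_ae ?_
        filter_upwards [hadd, Measure.rnDeriv_lt_top (ν - μ) μ] with x hx hfin
        rw [hx, Pi.add_apply, Pi.one_apply, ENNReal.toReal_add hfin.ne ENNReal.one_ne_top,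
          ENNReal.toReal_one, add_sub_cancel_right, Real.enorm_of_nonneg ENNReal.toReal_nonneg,
          ENNReal.ofReal_toReal hfin.ne]
    _ ≤ (ν - μ) univ := Measure.lintegral_rnDeriv_le
    _ = ν univ - μ univ := Measure.sub_apply MeasurableSet.univ h

theorem tendstoZeroL1_rnDeriv_sub_one {m : ℝ → Measure α} [IsFiniteMeasure ν]
    (hfin : ∀ᶠ t in atTop, IsFiniteMeasure (m t)) (hle : ∀ᶠ t in atTop, ν ≤ m t)
    (hlim : Tendsto (fun t => m t univ) atTop (𝓝 (ν univ))) :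
    TendstoZeroL1 ν fun t x => ((m t).rnDeriv ν x).toReal - 1 := by
  refine tendstoZeroL1_of_le (B := fun t => m t univ - ν univ) (.of_forall fun t => ?_) ?_ ?_
  · exact ((Measure.measurable_rnDeriv _ _).ennreal_toReal.sub_const 1).aestronglyMeasurable
  · filter_upwards [hfin, hle] with t _ ht using eLpNorm_rnDeriv_sub_one_le ht
  · simpa only [tsub_self] using
      ENNReal.Tendsto.sub hlim (tendsto_const_nhds (x := ν univ)) (.inl (measure_ne_top ν univ))

variable {β : Type*} [MeasurableSpace β] {τ : Measure β} {J : Set β}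

theorem restrict_prod_eq [SFinite τ] [SFinite ν] :
    (τ.restrict J).prod ν = (τ.prod ν).restrict (J ×ˢ univ) := by
  rw [← Measure.prod_restrict, Measure.restrict_univ]

theorem ae_fst_mem_of_restrict_prod [SFinite τ] [SFinite ν] (hJ : MeasurableSet J) :
    ∀ᵐ p ∂((τ.restrict J).prod ν), p.1 ∈ J := by
  rw [restrict_prod_eq]
  exact (ae_restrict_mem (hJ.prod MeasurableSet.univ)).mono fun p hp => hp.1

theorem eLpNorm_restrict_prod_le [SFinite ν] (hJ : MeasurableSet J) {m : β → Measure α}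
    {φ : β × α → ℝ} (hφ : AEStronglyMeasurable φ ((τ.restrict J).prod ν))
    (hν : ∀ u ∈ J, ν ≤ m u) :
    eLpNorm φ 1 ((τ.restrict J).prod ν) ≤ ∫⁻ u in J, ∫⁻ x, ‖φ (u, x)‖ₑ ∂m u ∂τ := by
  rw [eLpNorm_one_eq_lintegral_enorm, lintegral_prod _ hφ.enorm]
  exact setLIntegral_mono' hJ fun u hu => lintegral_mono' (hν u hu) le_rfl

end MonotoneFamilies

theorem aestronglyMeasurable_rescaled {X : Type*} [TopologicalSpace X] [SecondCountableTopology X]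
    [MeasurableSpace X] [BorelSpace X] {ν : Measure X} [SFinite ν] {I J : Set ℝ} {φ : ℝ × X → ℝ}
    (hφ : ContinuousOn φ (I ×ˢ univ)) (hJ : MeasurableSet J) {s : ℝ} (hs : ∀ u ∈ J, s * u ∈ I) :
    AEStronglyMeasurable (fun p : ℝ × X => φ (s * p.1, p.2)) ((volume.restrict J).prod ν) := by
  rw [restrict_prod_eq]
  exact (hφ.comp (f := fun p : ℝ × X => (s * p.1, p.2)) (by fun_prop)
    fun p hp => ⟨hs _ hp.1, trivial⟩).aestronglyMeasurable (hJ.prod MeasurableSet.univ)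

/-! ### The volume lost over a rescaled interval -/

theorem FlowData.IsEinsteinFlow.isFiniteMeasure_normalizedVolume {n : ℕ} {X : Type*}
    [TopologicalSpace X] [ChartedSpace (Coord n) X] [IsManifold (𝓡 n) ∞ X] [CompactSpace X]
    [MeasurableSpace X] [BorelSpace X] {I : Set ℝ} {F : FlowData n X} (hF : F.IsEinsteinFlow I)
    {t : ℝ} (ht : t ∈ I) : IsFiniteMeasure (F.normalizedVolume t) :=
  have := (hF.isRiemannian ht).isLocallyFiniteMeasure
  Measure.smul_finite _ ENNReal.ofReal_ne_top

namespace FlowData.IsExpandingCMC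

variable {n : ℕ} {X : Type*} [TopologicalSpace X] [ChartedSpace (Coord n) X] {I : Set ℝ}
  {F : FlowData n X} (hF : F.IsExpandingCMC I)

include hF

theorem rescaled_time_mem {Λ s u : ℝ} (hs₀ : 0 < s) (hs : s * Λ⁻¹ ∈ I) (hu : u ∈ Icc Λ⁻¹ Λ) :
    s * u ∈ I :=
  hF.isUpperSet (mul_le_mul_of_nonneg_left hu.1 hs₀.le) hs

theorem eventually_rescaled_time_mem {Λ : ℝ} (hΛ : 1 < Λ) :
    ∀ᶠ s in atTop, 0 < s ∧ s * Λ⁻¹ ∈ I :=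
  (eventually_gt_atTop 0).and <|
    (tendsto_id.atTop_mul_const (inv_pos.2 (one_pos.trans hΛ))).eventually hF.eventually_mem

theorem exists_limit_measure [IsManifold (𝓡 n) ∞ X] [CompactSpace X] [MeasurableSpace X]
    [BorelSpace X] (hanti : AntitoneOn F.normalizedVolume I) :
    ∃ ν : Measure X, IsFiniteMeasure ν ∧ (∀ t ∈ I, ν ≤ F.normalizedVolume t) ∧
      ∀ A, MeasurableSet A → Tendsto (fun t => F.normalizedVolume t A) atTop (𝓝 (ν A)) := by
  obtain ⟨a, ha⟩ := hF.eventually_mem.exists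
  have hmem (t : ℝ) : max a t ∈ I := hF.isUpperSet (le_max_left a t) ha
  have (t : ℝ) := hF.isFiniteMeasure_normalizedVolume (hmem t)
  obtain ⟨ν, hle, hlim⟩ := exists_measure_tendsto_of_antitone
    (μ := fun t => F.normalizedVolume (max a t))
    fun s t hst => hanti (hmem s) (hmem t) (max_le_max le_rfl hst)
  refine ⟨ν, isFiniteMeasure_of_le _ (hle a),
    fun t ht => (hle t).trans (hanti ht (hmem t) (le_max_right a t)), fun A hA => ?_⟩
  exact (hlim A hA).congr' ((eventually_ge_atTop a).mono fun t hat => by rw [max_eq_right hat])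

theorem continuousOn_rescaled {φ : ℝ → X → ℝ}
    (hφ : ContinuousOn (fun p : ℝ × X => φ p.1 p.2) (I ×ˢ univ)) {Λ s : ℝ} (hs₀ : 0 < s)
    (hs : s * Λ⁻¹ ∈ I) (x : X) : ContinuousOn (fun u => φ (s * u) x) (Icc Λ⁻¹ Λ) :=
  hφ.comp (f := fun u : ℝ => (s * u, x)) (by fun_prop)
    fun _ hu => ⟨hF.rescaled_time_mem hs₀ hs hu, trivial⟩

variable [Nonempty X] (hH : F.IsHubbleTime I) [IsManifold (𝓡 n) ∞ X] {Λ s t t₁ : ℝ}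

include hH

theorem hasDerivWithinAt_neg_density_rescaled (ht₁ : t₁ ∈ I) (hs₀ : 0 < s) {u : ℝ}
    (hu : s * u ∈ I) (x : X) :
    HasDerivWithinAt (fun v => -F.density t₁ (s * v) x)
      (n / u * ((1 - F.L (s * u) x) * F.density t₁ (s * u) x)) (Ioi u) u := by
  have hmaps : MapsTo (fun v => s * v) (Ioi u) I := fun v hv =>
    hF.isUpperSet (mul_le_mul_of_nonneg_left (le_of_lt hv) hs₀.le) hu
  refine ((hF.hasDerivWithinAt_density hH ht₁ hu x).comp u
    ((hasDerivAt_id u).const_mul s).hasDerivWithinAt hmaps).fun_neg.congr_deriv ?_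
  have : u ≠ 0 := (pos_of_mul_pos_right (hF.time_pos hH hu) hs₀.le).ne'
  field_simp

theorem abs_rescale_R_add (hs₀ : 0 < s) {u : ℝ} (hu : s * u ∈ I) (x : X) :
    |(F.rescale s).R u x + n * (n - 1) / u ^ 2| = (F.rescale s).K0sq u x := by
  have hu₀ : u ≠ 0 := (pos_of_mul_pos_right (hF.time_pos hH hu) hs₀.le).ne'
  have hR : (F.rescale s).R u x + n * (n - 1) / u ^ 2 = (F.rescale s).K0sq u x := by
    rw [F.rescale_R hs₀.ne', F.rescale_K0sq hs₀.ne', hF.R_eq hH hu]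
    field_simp
    ring
  rw [hR, F.rescale_K0sq hs₀.ne']
  exact abs_of_nonneg (mul_nonneg (sq_nonneg s) (hF.K0sq_nonneg hu x))

variable [CompactSpace X]

theorem lintegral_rate_mul_density_eq (ht₁ : t₁ ∈ I) (hΛ : 1 < Λ) (hs₀ : 0 < s)
    (hs : s * Λ⁻¹ ∈ I) (x : X) :
    ∫⁻ u in Icc Λ⁻¹ Λ,
        ENNReal.ofReal (n / u * ((1 - F.L (s * u) x) * F.density t₁ (s * u) x)) =
      ENNReal.ofReal (F.density t₁ (s * Λ⁻¹) x) - ENNReal.ofReal (F.density t₁ (s * Λ) x) := by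
  have hΛi : Λ⁻¹ ≤ Λ := (inv_le_one_of_one_le₀ hΛ.le).trans hΛ.le
  have hmem {u : ℝ} (hu : u ∈ Icc Λ⁻¹ Λ) : s * u ∈ I := hF.rescaled_time_mem hs₀ hs hu
  have hpos {u : ℝ} (hu : u ∈ Icc Λ⁻¹ Λ) : 0 < u := (inv_pos.2 (one_pos.trans hΛ)).trans_le hu.1
  have hdensity := hF.continuousOn_rescaled (hF.continuousOn_density hH ht₁) hs₀ hs x
  have hrate : ContinuousOn
      (fun u => n / u * ((1 - F.L (s * u) x) * F.density t₁ (s * u) x)) (Icc Λ⁻¹ Λ) :=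
    (continuousOn_const.div continuousOn_id fun u hu => (hpos hu).ne').mul
      ((continuousOn_const.sub (hF.continuousOn_rescaled hF.continuousOn_L hs₀ hs x)).mul
        hdensity)
  have hrate_nonneg (u : ℝ) (hu : u ∈ Icc Λ⁻¹ Λ) :
      0 ≤ n / u * ((1 - F.L (s * u) x) * F.density t₁ (s * u) x) :=
    mul_nonneg (div_nonneg n.cast_nonneg (hpos hu).le) <|
      mul_nonneg (sub_nonneg.2 (hF.lapse_le_one hH (hmem hu) x))
        (hF.density_pos hH ht₁ (hmem hu) x).le
  rw [← ofReal_integral_eq_lintegral_ofReal (hrate.integrableOn_compact isCompact_Icc)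
      ((ae_restrict_iff' measurableSet_Icc).2 (.of_forall hrate_nonneg)),
    integral_Icc_eq_integral_Ioc, ← intervalIntegral.integral_of_le hΛi,
    intervalIntegral.integral_eq_sub_of_hasDeriv_right_of_le hΛi hdensity.fun_neg
      (fun u hu => hF.hasDerivWithinAt_neg_density_rescaled hH ht₁ hs₀
        (hmem (Ioo_subset_Icc_self hu)) x)
      (ContinuousOn.intervalIntegrable (by rwa [uIcc_of_le hΛi])),
    neg_sub_neg, ENNReal.ofReal_sub _ (hF.density_pos hH ht₁ (hmem (right_mem_Icc.2 hΛi)) x).le]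

theorem lintegral_one_sub_L_mul_density_le (ht₁ : t₁ ∈ I) (hΛ : 1 < Λ) (hs₀ : 0 < s)
    (hs : s * Λ⁻¹ ∈ I) (x : X) :
    ∫⁻ u in Icc Λ⁻¹ Λ,
        ENNReal.ofReal (1 - F.L (s * u) x) * ENNReal.ofReal (F.density t₁ (s * u) x) ≤
      ENNReal.ofReal (Λ / n) * (ENNReal.ofReal (F.density t₁ (s * Λ⁻¹) x) -
        ENNReal.ofReal (F.density t₁ (s * Λ) x)) := by
  rw [← hF.lintegral_rate_mul_density_eq hH ht₁ hΛ hs₀ hs x,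
    ← lintegral_const_mul' _ _ ENNReal.ofReal_ne_top]
  refine setLIntegral_mono' measurableSet_Icc fun u hu => ?_
  have hu₀ : 0 < u := (inv_pos.2 (one_pos.trans hΛ)).trans_le hu.1
  have hmem := hF.rescaled_time_mem hs₀ hs hu
  have hn : (0 : ℝ) < n := Nat.cast_pos.2 (hF.dim_pos hH)
  have hL := sub_nonneg.2 (hF.lapse_le_one hH hmem x)
  rw [← ENNReal.ofReal_mul hL, ← ENNReal.ofReal_mul (div_nonneg (hu₀.le.trans hu.2) hn.le),
    ← mul_assoc, div_mul_div_cancel₀ hn.ne']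
  exact ENNReal.ofReal_le_ofReal <| le_mul_of_one_le_left
    (mul_nonneg hL (hF.density_pos hH ht₁ hmem x).le) ((one_le_div hu₀).2 hu.2)

variable [MeasurableSpace X] [BorelSpace X]

theorem lintegral_normalizedVolume (ht₁ : t₁ ∈ I) (ht : t ∈ I) {φ : X → ℝ≥0∞}
    (hφ : Measurable φ) : ∫⁻ x, φ x ∂F.normalizedVolume t =
      ∫⁻ x, φ x * ENNReal.ofReal (F.density t₁ t x) ∂(F.h t₁).volumeMeasure := by
  have hdensity := continuous_slice (hF.continuousOn_density hH ht₁) ht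
  rw [hF.normalizedVolume_eq hH ht₁ ht,
    lintegral_withDensity_eq_lintegral_mul _ hdensity.measurable.ennreal_ofReal hφ]
  exact lintegral_congr fun x => mul_comm _ _

theorem lintegral_density_sub (ht₁ : t₁ ∈ I) {a b : ℝ} (ha : a ∈ I) (hb : b ∈ I) (hab : a ≤ b) :
    ∫⁻ x, (ENNReal.ofReal (F.density t₁ a x) - ENNReal.ofReal (F.density t₁ b x))
        ∂(F.h t₁).volumeMeasure =
      F.normalizedVolume a univ - F.normalizedVolume b univ := by
  have hmass {t : ℝ} (ht : t ∈ I) : ∫⁻ x, ENNReal.ofReal (F.density t₁ t x)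
      ∂(F.h t₁).volumeMeasure = F.normalizedVolume t univ := by
    simpa using (hF.lintegral_normalizedVolume hH ht₁ ht measurable_one).symm
  have hmeas := (continuous_slice (hF.continuousOn_density hH ht₁) hb).measurable.ennreal_ofReal
  have := hF.isFiniteMeasure_normalizedVolume hb
  rw [lintegral_sub hmeas (by rw [hmass hb]; exact measure_ne_top _ _)
    (.of_forall fun x => ENNReal.ofReal_le_ofReal (hF.antitoneOn_density hH ht₁ x ha hb hab)),
    hmass ha, hmass hb]

theorem lintegral_one_sub_L_le (hΛ : 1 < Λ) (hs₀ : 0 < s) (hs : s * Λ⁻¹ ∈ I) :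
    ∫⁻ u in Icc Λ⁻¹ Λ, ∫⁻ x, ENNReal.ofReal (1 - F.L (s * u) x) ∂F.normalizedVolume (s * u) ≤
      ENNReal.ofReal (Λ / n) *
        (F.normalizedVolume (s * Λ⁻¹) univ - F.normalizedVolume (s * Λ) univ) := by
  have := (hF.isRiemannian hs).isLocallyFiniteMeasure
  have : SecondCountableTopology X := ChartedSpace.secondCountable_of_sigmaCompact (Coord n) X
  have hΛi : Λ⁻¹ ≤ Λ := (inv_le_one_of_one_le₀ hΛ.le).trans hΛ.le
  set μ := (F.h (s * Λ⁻¹)).volumeMeasure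
  set q := fun u x => F.density (s * Λ⁻¹) (s * u) x
  have hmem {u : ℝ} (hu : u ∈ Icc Λ⁻¹ Λ) : s * u ∈ I := hF.rescaled_time_mem hs₀ hs hu
  have measurable_rescaled {φ : ℝ → X → ℝ}
      (hφ : ContinuousOn (fun p : ℝ × X => φ p.1 p.2) (I ×ˢ univ)) :
      AEMeasurable (fun p : ℝ × X => ENNReal.ofReal (φ (s * p.1) p.2))
        ((volume.restrict (Icc Λ⁻¹ Λ)).prod μ) :=
    (aestronglyMeasurable_rescaled hφ measurableSet_Icc
      fun _ => hmem).aemeasurable.ennreal_ofReal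
  calc ∫⁻ u in Icc Λ⁻¹ Λ, ∫⁻ x, ENNReal.ofReal (1 - F.L (s * u) x) ∂F.normalizedVolume (s * u)
      = ∫⁻ u in Icc Λ⁻¹ Λ,
          ∫⁻ x, ENNReal.ofReal (1 - F.L (s * u) x) * ENNReal.ofReal (q u x) ∂μ :=
        setLIntegral_congr_fun measurableSet_Icc fun u hu =>
          hF.lintegral_normalizedVolume hH hs (hmem hu)
            ((hF.continuous_L (hmem hu)).measurable.const_sub 1).ennreal_ofReal
    _ = ∫⁻ x, (∫⁻ u in Icc Λ⁻¹ Λ,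
          ENNReal.ofReal (1 - F.L (s * u) x) * ENNReal.ofReal (q u x)) ∂μ :=
        lintegral_lintegral_swap <|
          (measurable_rescaled (φ := fun t x => 1 - F.L t x)
            (continuousOn_const.sub hF.continuousOn_L)).fun_mul
              (measurable_rescaled (hF.continuousOn_density hH hs))
    _ ≤ ∫⁻ x, ENNReal.ofReal (Λ / n) *
          (ENNReal.ofReal (q Λ⁻¹ x) - ENNReal.ofReal (q Λ x)) ∂μ :=
        lintegral_mono fun x => hF.lintegral_one_sub_L_mul_density_le hH hs hΛ hs₀ hs x
    _ = ENNReal.ofReal (Λ / n) *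
          (F.normalizedVolume (s * Λ⁻¹) univ - F.normalizedVolume (s * Λ) univ) := by
        rw [lintegral_const_mul' _ _ ENNReal.ofReal_ne_top,
          hF.lintegral_density_sub hH hs hs (hmem (right_mem_Icc.2 hΛi))
            (mul_le_mul_of_nonneg_left hΛi hs₀.le)]

theorem lintegral_K0sq_mul_L [T2Space X] (ht : t ∈ I) :
    ∫⁻ x, ENNReal.ofReal (F.K0sq t x * F.L t x) ∂F.normalizedVolume t =
      ENNReal.ofReal (n / t ^ 2) * ∫⁻ x, ENNReal.ofReal (1 - F.L t x) ∂F.normalizedVolume t := by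
  have := (hF.isRiemannian ht).isLocallyFiniteMeasure
  have hL := hF.continuous_L ht
  have hK := hF.continuous_K0sq ht
  have lintegral_eq {φ : X → ℝ} (hφ : Continuous φ) (hφ_nonneg : ∀ x, 0 ≤ φ x) :
      ∫⁻ x, ENNReal.ofReal (φ x) ∂F.normalizedVolume t =
        ENNReal.ofReal (t ^ n)⁻¹ * ENNReal.ofReal (∫ x, φ x ∂(F.h t).volumeMeasure) := by
    rw [FlowData.normalizedVolume, lintegral_smul_measure, smul_eq_mul,
      ofReal_integral_eq_lintegral_ofReal
        (hφ.integrable_of_hasCompactSupport (.of_compactSpace _)) (.of_forall hφ_nonneg)]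
  rw [lintegral_eq (hK.fun_mul hL) fun x =>
      mul_nonneg (hF.K0sq_nonneg ht x) (hF.lapse_nonneg t ht x),
    lintegral_eq (continuous_const.fun_sub hL) fun x => sub_nonneg.2 (hF.lapse_le_one hH ht x),
    hF.integral_K0sq_mul_L hH ht, ENNReal.ofReal_mul (by positivity), mul_left_comm]

theorem lintegral_rescaled_K0sq_mul_L_le [T2Space X] (hΛ : 1 < Λ) (hs₀ : 0 < s) (hs : s * Λ⁻¹ ∈ I)
    {u : ℝ} (hu : u ∈ Icc Λ⁻¹ Λ) :
    ∫⁻ x, ‖s ^ 2 * (F.K0sq (s * u) x * F.L (s * u) x)‖ₑ ∂F.normalizedVolume (s * u) ≤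
      ENNReal.ofReal (n * Λ ^ 2) *
        ∫⁻ x, ENNReal.ofReal (1 - F.L (s * u) x) ∂F.normalizedVolume (s * u) := by
  have hmem := hF.rescaled_time_mem hs₀ hs hu
  have hΛ₀ : 0 < Λ := one_pos.trans hΛ
  have hu₀ : 0 < u := (inv_pos.2 hΛ₀).trans_le hu.1
  have hcoeff : s ^ 2 * (n / (s * u) ^ 2) ≤ n * Λ ^ 2 := by
    have : u⁻¹ ≤ Λ := inv_le_of_inv_le₀ hΛ₀ hu.1
    calc s ^ 2 * (n / (s * u) ^ 2) = n * u⁻¹ ^ 2 := by field_simp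
      _ ≤ n * Λ ^ 2 := by gcongr
  have henorm (x : X) : ‖s ^ 2 * (F.K0sq (s * u) x * F.L (s * u) x)‖ₑ =
      ENNReal.ofReal (s ^ 2) * ENNReal.ofReal (F.K0sq (s * u) x * F.L (s * u) x) := by
    rw [Real.enorm_of_nonneg (mul_nonneg (sq_nonneg s) (mul_nonneg (hF.K0sq_nonneg hmem x)
      (hF.lapse_nonneg _ hmem x))), ENNReal.ofReal_mul (sq_nonneg s)]
  simp only [henorm]
  rw [lintegral_const_mul' _ _ ENNReal.ofReal_ne_top, hF.lintegral_K0sq_mul_L hH hmem, ← mul_assoc,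
    ← ENNReal.ofReal_mul (sq_nonneg s)]
  gcongr

/-! ### Convergence of the rescaled flows -/

variable {ν : Measure X} [IsFiniteMeasure ν] (hle : ∀ t ∈ I, ν ≤ F.normalizedVolume t)
  (hlim : Tendsto (fun t => F.normalizedVolume t univ) atTop (𝓝 (ν univ)))

include hle hlim

theorem tendstoZeroL1_L (hΛ : 1 < Λ) :
    TendstoZeroL1 ((volume.restrict (Icc Λ⁻¹ Λ)).prod ν)
      fun s p => (F.rescale s).L p.1 p.2 - 1 := by
  have : SecondCountableTopology X := ChartedSpace.secondCountable_of_sigmaCompact (Coord n) X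
  have hmeas : ∀ᶠ s in atTop, AEStronglyMeasurable (fun p : ℝ × X => F.L (s * p.1) p.2 - 1)
      ((volume.restrict (Icc Λ⁻¹ Λ)).prod ν) := by
    filter_upwards [hF.eventually_rescaled_time_mem hΛ] with s ⟨hs₀, hs⟩
    exact aestronglyMeasurable_rescaled (hF.continuousOn_L.sub continuousOn_const)
      measurableSet_Icc fun _ hu => hF.rescaled_time_mem hs₀ hs hu
  refine tendstoZeroL1_of_le hmeas ?_
    (tendsto_ofReal_mul_sub_rescaled hlim (measure_ne_top ν univ)
      (one_pos.trans hΛ) (Λ / n))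
  filter_upwards [hmeas, hF.eventually_rescaled_time_mem hΛ] with s hs_meas ⟨hs₀, hs⟩
  have hmem {u : ℝ} (hu : u ∈ Icc Λ⁻¹ Λ) : s * u ∈ I := hF.rescaled_time_mem hs₀ hs hu
  refine (eLpNorm_restrict_prod_le measurableSet_Icc hs_meas fun u hu => hle _ (hmem hu)).trans
    ((setLIntegral_mono' measurableSet_Icc fun u hu => ?_).trans
      (hF.lintegral_one_sub_L_le hH hΛ hs₀ hs))
  refine lintegral_mono fun x => ?_
  rw [← enorm_neg, neg_sub,
    Real.enorm_of_nonneg (sub_nonneg.2 (hF.lapse_le_one hH (hmem hu) x))]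

theorem tendstoZeroL1_K0sq_mul_L [T2Space X] (hΛ : 1 < Λ) :
    TendstoZeroL1 ((volume.restrict (Icc Λ⁻¹ Λ)).prod ν)
      fun s p => (F.rescale s).K0sq p.1 p.2 * (F.rescale s).L p.1 p.2 := by
  have : SecondCountableTopology X := ChartedSpace.secondCountable_of_sigmaCompact (Coord n) X
  have hmeas : ∀ᶠ s in atTop, AEStronglyMeasurable
      (fun p : ℝ × X => s ^ 2 * (F.K0sq (s * p.1) p.2 * F.L (s * p.1) p.2))
      ((volume.restrict (Icc Λ⁻¹ Λ)).prod ν) := by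
    filter_upwards [hF.eventually_rescaled_time_mem hΛ] with s ⟨hs₀, hs⟩
    exact (aestronglyMeasurable_rescaled (hF.continuousOn_K0sq.mul hF.continuousOn_L)
      measurableSet_Icc fun _ hu => hF.rescaled_time_mem hs₀ hs hu).const_mul (s ^ 2)
  have hzero : TendstoZeroL1 ((volume.restrict (Icc Λ⁻¹ Λ)).prod ν)
      fun s p => s ^ 2 * (F.K0sq (s * p.1) p.2 * F.L (s * p.1) p.2) := by
    refine tendstoZeroL1_of_le hmeas ?_
      (tendsto_ofReal_mul_sub_rescaled hlim (measure_ne_top ν univ)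
      (one_pos.trans hΛ) (n * Λ ^ 2 * (Λ / n)))
    filter_upwards [hmeas, hF.eventually_rescaled_time_mem hΛ] with s hs_meas ⟨hs₀, hs⟩
    refine (eLpNorm_restrict_prod_le measurableSet_Icc hs_meas fun u hu =>
      hle _ (hF.rescaled_time_mem hs₀ hs hu)).trans ((setLIntegral_mono' measurableSet_Icc
        fun u hu => hF.lintegral_rescaled_K0sq_mul_L_le hH hΛ hs₀ hs hu).trans ?_)
    rw [lintegral_const_mul' _ _ ENNReal.ofReal_ne_top,
      ENNReal.ofReal_mul (p := n * Λ ^ 2) (by positivity), mul_assoc (ENNReal.ofReal _)]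
    exact mul_le_mul_right (hF.lintegral_one_sub_L_le hH hΛ hs₀ hs) _
  refine hzero.congr ((eventually_ne_atTop 0).mono fun s hs => .of_forall fun p => ?_)
  simp only [F.rescale_K0sq hs, mul_assoc]
  rfl

theorem tendstoZeroL1_R [T2Space X] (hΛ : 1 < Λ) :
    TendstoZeroL1 ((volume.restrict (Icc Λ⁻¹ Λ)).prod ν)
      fun s p => |(F.rescale s).R p.1 p.2 + n * (n - 1) / p.1 ^ 2| * (F.rescale s).L p.1 p.2 := by
  refine (hF.tendstoZeroL1_K0sq_mul_L hH hle hlim hΛ).congr ?_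
  filter_upwards [hF.eventually_rescaled_time_mem hΛ] with s ⟨hs₀, hs⟩
  filter_upwards [ae_fst_mem_of_restrict_prod measurableSet_Icc] with p hp
  rw [hF.abs_rescale_R_add hH hs₀ (hF.rescaled_time_mem hs₀ hs hp)]

end FlowData.IsExpandingCMC

end

theorem proposition1p37 {n : ℕ} {X : Type*} [TopologicalSpace X] [ChartedSpace (Coord n) X]
    [IsManifold (𝓡 n) ∞ X] [T2Space X] [CompactSpace X] [MeasurableSpace X] [BorelSpace X]
    (I : Set ℝ) (F : FlowData n X) (hF : F.IsExpandingCMC I) (ht : F.IsHubbleTime I) :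
    AntitoneOn F.normalizedVolume I ∧
    ∃ volInf : Measure X, IsFiniteMeasure volInf ∧
      (∀ A : Set X, MeasurableSet A →
        Tendsto (fun t => F.normalizedVolume t A) atTop (𝓝 (volInf A))) ∧
      (∀ t ∈ I, volInf ≪ (F.h t).volumeMeasure) ∧
      TendstoZeroL1 volInf
        (fun t x => ((F.normalizedVolume t).rnDeriv volInf x).toReal - 1) ∧
      ∀ Λ : ℝ, 1 < Λ →
        TendstoZeroL1 ((volume.restrict (Icc Λ⁻¹ Λ)).prod volInf)
          (fun s p => (F.rescale s).L p.1 p.2 - 1) ∧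
        TendstoZeroL1 ((volume.restrict (Icc Λ⁻¹ Λ)).prod volInf)
          (fun s p => (F.rescale s).K0sq p.1 p.2 * (F.rescale s).L p.1 p.2) ∧
        TendstoZeroL1 ((volume.restrict (Icc Λ⁻¹ Λ)).prod volInf)
          (fun s p => |(F.rescale s).R p.1 p.2 + n * (n - 1) / p.1 ^ 2|
            * (F.rescale s).L p.1 p.2) := by
  rcases isEmpty_or_nonempty X with _ | _
  · have hzero (t : ℝ) : F.normalizedVolume t = 0 := Measure.eq_zero_of_isEmpty _
    refine ⟨fun _ _ _ _ _ => by simp only [hzero, le_refl], 0, inferInstance, fun A _ => ?_,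
      fun _ _ => .zero _, tendstoZeroL1_zero_measure _, fun Λ _ => ?_⟩
    · simpa only [hzero] using tendsto_const_nhds
    · rw [Measure.prod_zero]
      exact ⟨tendstoZeroL1_zero_measure _, tendstoZeroL1_zero_measure _,
        tendstoZeroL1_zero_measure _⟩
  · have hanti := hF.antitoneOn_normalizedVolume ht
    obtain ⟨ν, _, hle, hlim⟩ := hF.exists_limit_measure hanti
    have hmass := hlim univ MeasurableSet.univ
    refine ⟨hanti, ν, inferInstance, hlim, fun t h => ?_, ?_, fun Λ hΛ => ?_⟩
    · exact (Measure.absolutelyContinuous_of_le (hle t h)).trans Measure.smul_absolutelyContinuous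
    · exact tendstoZeroL1_rnDeriv_sub_one
        (hF.eventually_mem.mono fun _ => hF.isFiniteMeasure_normalizedVolume)
        (hF.eventually_mem.mono hle) hmass
    · exact ⟨hF.tendstoZeroL1_L ht hle hmass hΛ, hF.tendstoZeroL1_K0sq_mul_L ht hle hmass hΛ,
        hF.tendstoZeroL1_R ht hle hmass hΛ⟩
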